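/- Let $\mathcal H$ be a finite-dimensional complex Hilbert space, $I$ a finite set, and $(V_i)_{i\in I}$ an irreducible Kraus family on $\mathcal H$: operators with $\sum_{i} V_i^*V_i=\mathrm{Id}$ such that the only subspaces $E\subset\mathcal H$ with $V_iE\subset E$ for all $i$ are $\{0\}$ and $\mathcal H$. Let $v=(v_i)_{i\in I}$ be strictly positive real numbers, and for $\alpha\in\mathbb R$ put $$\Phi(\rho)=\sum_i V_i\rho V_i^*,\quad \Phi^{(\alpha)}(\rho)=\sum_i v_i^\alpha\,V_i\rho V_i^*,\quad \Phi^*(X)=\sum_i V_i^*XV_i,\quad \Phi^{(\alpha)*}(X)=\sum_i v_i^\alpha\,V_i^*XV_i .$$ The peripheral spectrum of a linear map on $\mathcal B(\mathcal H)$ is the set of its eigenvalues whose modulus is the spectral radius. Let $z$ be the number of elements of the peripheral spectrum of $\Phi$, $\theta=e^{2\pi \mathrm i/z}$ and $S_z=\{\theta^m : m=0,\dots,z-1\}$. Let $u$ be a Perron--Frobenius unitary of $\Phi$, i.e. a unitary operator commuting with a faithful (positive-definite, trace-one) state $\rho^{\mathrm{inv}}$ with $\Phi(\rho^{\mathrm{inv}})=\rho^{\mathrm{inv}}$,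 such that $u^z=\mathrm{Id}$, $u^k\ne\mathrm{Id}$ for $0<k<z$, and $$\Phi(\rho u)=\theta\,\Phi(\rho)u,\qquad \Phi^*(uX)=\overline\theta\,u\,\Phi^*(X)\qquad\text{for all operators }\rho, X .$$ Then the peripheral spectrum of $\Phi$ is $S_z$, and there exist real-analytic (in particular smooth) maps $\alpha\mapsto\lambda^{(\alpha)},\ \mathrm I^{(\alpha)},\ \rho^{(\alpha)}$ from $\mathbb R$ to, respectively, $(0,\infty)$, the positive-definite operators, and the faithful states, such that for every $\alpha\in\mathbb R$: 1. the peripheral spectrum of $\Phi^{(\alpha)}$ is $\lambda^{(\alpha)}S_z=\{\lambda^{(\alpha)}\theta^k : k=0,\dots,z-1\}$; 2. $[\mathrm I^{(\alpha)},u]=0$ and $[\rho^{(\alpha)},u]=0$; 3. $\operatorname{Tr}(\rho^{(\alpha)}\mathrm I^{(\alpha)})=1$; 4. for $m=0,\dots,z-1$, the eigenvector of $\Phi^{(\alpha)}$ (resp. $\Phi^{(\alpha)*}$) for the eigenvalue $\lambda^{(\alpha)}\theta^m$, unique up to a multiplicative constant, is $\rho^{(\alpha)}u^m$ (resp. $\mathrm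 I^{(\alpha)}u^{-m}$), and the spectral projector of $\Phi^{(\alpha)}$ associated with $\lambda^{(\alpha)}\theta^m$ (the projector onto its generalized eigenspace along the sum of the other generalized eigenspaces) is $$\eta\mapsto \operatorname{Tr}(\mathrm I^{(\alpha)}u^{-m}\eta)\,\rho^{(\alpha)}u^m .$$ -/

import Mathlib

open scoped InnerProductSpace

noncomputable section

namespace KrausDeformation

variable {H : Type*} [NormedAddCommGroup H] [InnerProductSpace ℂ H] [CompleteSpace H]
variable {I : Type*} [Fintype I]

/-- The trace on the bounded operators of a (finite-dimensional) Hilbert space. -/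
def opTrace : (H →L[ℂ] H) →ₗ[ℂ] ℂ :=
  LinearMap.trace ℂ H ∘ₗ ContinuousLinearMap.coeLM ℂ

/-- The linear map `X ↦ A X B` on operators. -/
def sandwich (A B : H →L[ℂ] H) : Module.End ℂ (H →L[ℂ] H) :=
  LinearMap.mulLeft ℂ A ∘ₗ LinearMap.mulRight ℂ B

/-- The linear map `η ↦ Tr (A η) B` on operators. -/
def traceRankOne (A B : H →L[ℂ] H) : Module.End ℂ (H →L[ℂ] H) :=
  (opTrace ∘ₗ LinearMap.mulLeft ℂ A).smulRight B

/-- Positive-definite operators. -/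
def IsPosDef (A : H →L[ℂ] H) : Prop :=
  IsSelfAdjoint A ∧ ∀ x : H, x ≠ 0 → 0 < (⟪x, A x⟫_ℂ).re

/-- Faithful states: positive-definite operators of trace one. -/
def IsFaithfulState (A : H →L[ℂ] H) : Prop :=
  IsPosDef A ∧ opTrace A = 1

/-- The map `Φ(ρ) = ∑ i, V i ρ (V i)^*`. -/
def krausMap (V : I → H →L[ℂ] H) : Module.End ℂ (H →L[ℂ] H) :=
  ∑ i, sandwich (V i) (star (V i))

/-- The trace dual `Φ^*(X) = ∑ i, (V i)^* X (V i)`. -/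
def krausDual (V : I → H →L[ℂ] H) : Module.End ℂ (H →L[ℂ] H) :=
  ∑ i, sandwich (star (V i)) (V i)

/-- The deformation `Φ^(α)(ρ) = ∑ i, (v i)^α V i ρ (V i)^*`. -/
def deformedMap (V : I → H →L[ℂ] H) (v : I → ℝ) (α : ℝ) : Module.End ℂ (H →L[ℂ] H) :=
  ∑ i, ((v i ^ α : ℝ) : ℂ) • sandwich (V i) (star (V i))

/-- The trace dual `Φ^(α)^*(X) = ∑ i, (v i)^α (V i)^* X (V i)`. -/
def deformedDual (V : I → H →L[ℂ] H) (v : I → ℝ) (α : ℝ) : Module.End ℂ (H →L[ℂ] H) :=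
  ∑ i, ((v i ^ α : ℝ) : ℂ) • sandwich (star (V i)) (V i)

theorem opTrace_mul_comm (A B : H →L[ℂ] H) : opTrace (A * B) = opTrace (B * A) := by
  simpa [opTrace] using LinearMap.trace_mul_comm ℂ (A : H →ₗ[ℂ] H) (B : H →ₗ[ℂ] H)

theorem deformedMap_zero (V : I → H →L[ℂ] H) (v : I → ℝ) : deformedMap V v 0 = krausMap V := by
  simp [deformedMap, krausMap]

/-- `deformedDual` is the dual of `deformedMap` for the pairing `(ρ, X) ↦ Tr (ρ X)`. -/
theorem opTrace_deformedMap_mul (V : I → H →L[ℂ] H) (v : I → ℝ) (α : ℝ) (ρ X : H →L[ℂ] H) :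
    opTrace (deformedMap V v α ρ * X) = opTrace (ρ * deformedDual V v α X) := by
  simp only [deformedMap, deformedDual, sandwich, LinearMap.sum_apply, LinearMap.smul_apply,
    LinearMap.comp_apply, LinearMap.mulLeft_apply, LinearMap.mulRight_apply, Finset.sum_mul,
    Finset.mul_sum, map_sum, smul_mul_assoc, mul_smul_comm, map_smul]
  refine Finset.sum_congr rfl fun i _ => ?_
  congr 1
  rw [mul_assoc, opTrace_mul_comm]
  simp only [mul_assoc]

/-- Irreducible Kraus families: `∑ i, (V i)^* V i = Id`, and the only subspaces invariant under
all the `V i` are `{0}` and the whole space. -/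
def IsIrreducibleKrausFamily (V : I → H →L[ℂ] H) : Prop :=
  ∑ i, star (V i) * V i = 1 ∧
    ∀ E : Submodule ℂ H, (∀ i, ∀ x ∈ E, V i x ∈ E) → E = ⊥ ∨ E = ⊤

/-- The peripheral spectrum: the elements of the spectrum whose modulus is the spectral radius. -/
def peripheralSpectrum (T : Module.End ℂ (H →L[ℂ] H)) : Set ℂ :=
  {μ | μ ∈ spectrum ℂ T ∧ (‖μ‖₊ : ENNReal) = spectralRadius ℂ T}

/-- `exp (2 π i / z)`. -/
def theta (z : ℕ) : ℂ := Complex.exp (2 * Real.pi * Complex.I / z)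

/-- The group `S_z = {θ^m | m = 0, …, z - 1}` of `z`-th roots of unity, `θ = exp (2 π i / z)`. -/
def rootsGroup (z : ℕ) : Set ℂ := {μ | ∃ m : ℕ, m < z ∧ μ = theta z ^ m}

/-- The number `z` of peripheral eigenvalues of `Φ`. -/
def period (V : I → H →L[ℂ] H) : ℕ := (peripheralSpectrum (krausMap V)).ncard

/-- Perron–Frobenius unitaries of the map `Φ` given by `V`: unitaries `u` of order `z`, commuting
with a faithful invariant state of `Φ`, such that `Φ(ρ u) = θ Φ(ρ) u` and
`Φ^*(u X) = conj θ u Φ^*(X)`. -/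
structure IsPerronFrobeniusUnitary (V : I → H →L[ℂ] H) (u : unitary (H →L[ℂ] H)) : Prop where
  exists_state : ∃ ρ : H →L[ℂ] H, IsFaithfulState ρ ∧ krausMap V ρ = ρ ∧
    Commute ρ (u : H →L[ℂ] H)
  pow_period : u ^ period V = 1
  pow_ne_one : ∀ k : ℕ, 0 < k → k < period V → u ^ k ≠ 1
  map_mul : ∀ ρ : H →L[ℂ] H, krausMap V (ρ * u) = theta (period V) • (krausMap V ρ * u)
  dual_mul : ∀ X : H →L[ℂ] H,
    krausDual V (u * X) = (starRingEnd ℂ) (theta (period V)) • (u * krausDual V X)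

/-- `P` is the spectral (Riesz) projector of `T` associated with `μ`: the projector onto the
generalized eigenspace for `μ` along the sum of the other generalized eigenspaces. -/
structure IsSpectralProjector (T : Module.End ℂ (H →L[ℂ] H)) (μ : ℂ)
    (P : Module.End ℂ (H →L[ℂ] H)) : Prop where
  idem : P * P = P
  range_eq : LinearMap.range P = T.maxGenEigenspace μ
  ker_eq : LinearMap.ker P = ⨆ ν : ℂ, ⨆ _ : ν ≠ μ, T.maxGenEigenspace ν

end KrausDeformation

end

/-!
With `W i = √(v i ^ α) V i`, the deformation `Φ^(α)` is the map `Φ_W : X ↦ ∑ i, W i X (W i)^*`, and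
`W` has the same invariant subspaces as `V`. The proof rests on four facts about such families `W`.

*Existence.* A Collatz–Wielandt argument (`IsIrreducibleFamily.exists_perron`) gives
positive-definite eigenvectors `ρ` of `Φ_W` and `J` of its dual. Pairing them shows that the two
eigenvalues are the same number `t > 0`.

*Rigidity.* Since `ρ` is invertible, every eigenvector of `Φ_W` has the form `ρ S`; let `μ` be its
eigenvalue and `c = μ / t`. For `D i = S (W i)^* - c (W i)^* S`, the sum of the `(D i)^* ρ (D i)`
equals `Φ_W(S^* ρ S) - (|μ|² / t) S^* ρ S`. Pairing this positive operator with `J` gives `|μ| ≤ t`,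
and in the case of equality all `D i` vanish (`IsPerronTriple.norm_le_and_isTwist`): `S` is a twist
of the family, `S (W i)^* = c (W i)^* S`. For `c = 1`, Schur's lemma makes `S` scalar, so the
eigenvalue `t` is geometrically simple. In general `t⁻¹` times the peripheral spectrum is the set of
phases of twists (`IsPerronTriple.mem_peripheralSpectrum_iff`), and this set does not see the scalar
factors `√(v i ^ α)`: it is the same for all `α`. For `α = 0` it is the peripheral spectrum of `Φ`,
with `z` elements.

*The unitary.* The covariance of `Φ` under `u` forces that of each Kraus operator
(`isTwist_of_krausMap_mul`), so `u ^ m` is a twist with phase `θ ^ m`. These `z` phases exhaust the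
peripheral spectrum of `Φ`, right multiplication by `u ^ m` carries the Perron eigenspace onto the
eigenspace of `t θ ^ m`, and the functional `η ↦ Tr (J u^{-m} η)`, an eigenvector of the transpose
with value `1` on `ρ u ^ m`, gives the spectral projector (`isSpectralProjector_smulRight`).

*Analyticity.* The trace-one Perron eigenvector solves `Φ^(α)(X) = Tr(Φ^(α)(X)) X`. The
linearization of this equation is injective, so the implicit function theorem provides an analytic
branch of solutions near each parameter; solutions with positive-definite real part are Perron
eigenvectors, so this branch is `ρ^(α)` (`analyticOnNhd_perron`). The same applies to the dual.
-/

set_option linter.unusedSectionVars false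

open scoped InnerProductSpace

noncomputable section

namespace KrausDeformation

variable {H : Type*} [NormedAddCommGroup H] [InnerProductSpace ℂ H] [CompleteSpace H]
variable {I : Type*} [Fintype I]

/-! ### Positive-definite operators and the trace pairing -/

theorem opTrace_eq_sum_inner {ι : Type*} [Fintype ι] (b : OrthonormalBasis ι ℂ H)
    (A : H →L[ℂ] H) : opTrace A = ∑ k, ⟪b k, A (b k)⟫_ℂ := by
  simpa [opTrace] using LinearMap.trace_eq_sum_inner (A : H →ₗ[ℂ] H) b

theorem IsPosDef.im_inner {A : H →L[ℂ] H} (hA : IsPosDef A) (x : H) : (⟪x, A x⟫_ℂ).im = 0 := by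
  refine Complex.conj_eq_iff_im.1 ?_
  rw [inner_conj_symm]
  exact hA.1.isSymmetric x x

theorem IsPosDef.nonneg {A : H →L[ℂ] H} (hA : IsPosDef A) : 0 ≤ A := by
  rw [ContinuousLinearMap.nonneg_iff_isPositive, ContinuousLinearMap.isPositive_def']
  refine ⟨hA.1, fun x => ?_⟩
  rcases eq_or_ne x 0 with rfl | hx
  · simp [ContinuousLinearMap.reApplyInnerSelf_apply]
  · rw [ContinuousLinearMap.reApplyInnerSelf_apply, inner_re_symm]
    exact (hA.2 x hx).le

theorem re_inner_nonneg {A : H →L[ℂ] H} (hA : 0 ≤ A) (x : H) : 0 ≤ (⟪x, A x⟫_ℂ).re :=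
  ((ContinuousLinearMap.nonneg_iff_isPositive A).1 hA).re_inner_nonneg_right x

/-- For a positive semidefinite operator, the quadratic form vanishes exactly on the kernel. -/
theorem apply_eq_zero_of_re_inner_eq_zero {A : H →L[ℂ] H} (hA : 0 ≤ A) {x : H}
    (h : (⟪x, A x⟫_ℂ).re = 0) : A x = 0 := by
  obtain ⟨B, rfl⟩ := CStarAlgebra.nonneg_iff_eq_star_mul_self.1 hA
  rw [mul_apply_eq_comp, ContinuousLinearMap.star_eq_adjoint,
      ContinuousLinearMap.adjoint_inner_right, inner_self_eq_norm_sq_to_K] at h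
  have : B x = 0 := by
    rw [← norm_eq_zero, ← sq_eq_zero_iff, ← h]
    norm_cast
  simp [this]

/-- A positive semidefinite operator is definite as soon as it is injective. -/
theorem isPosDef_of_nonneg {A : H →L[ℂ] H} (hA : 0 ≤ A) (h : ∀ x, A x = 0 → x = 0) :
    IsPosDef A :=
  ⟨IsSelfAdjoint.of_nonneg hA, fun x hx => (re_inner_nonneg hA x).lt_of_ne fun h0 =>
    hx (h x (apply_eq_zero_of_re_inner_eq_zero hA h0.symm))⟩

theorem isPosDef_one : IsPosDef (1 : H →L[ℂ] H) :=
  isPosDef_of_nonneg zero_le_one fun x hx => by simpa using hx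

theorem IsPosDef.smul {A : H →L[ℂ] H} (hA : IsPosDef A) {r : ℝ} (hr : 0 < r) :
    IsPosDef ((r : ℂ) • A) := by
  refine ⟨?_, fun x hx => ?_⟩
  · rw [isSelfAdjoint_iff, star_smul, hA.1.star_eq]
    simp
  · have := mul_pos hr (hA.2 x hx)
    rw [smul_apply, inner_smul_right]
    simpa using this

variable [FiniteDimensional ℂ H]

/-- A positive-definite operator is diagonal with positive entries in some orthonormal basis. -/
theorem IsPosDef.exists_eigenbasis {A : H →L[ℂ] H} (hA : IsPosDef A) :
    ∃ (b : OrthonormalBasis (Fin (Module.finrank ℂ H)) ℂ H)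
      (r : Fin (Module.finrank ℂ H) → ℝ),
      (∀ k, 0 < r k) ∧ ∀ k, A (b k) = (r k : ℂ) • b k := by
  have hs : (A : H →ₗ[ℂ] H).IsSymmetric := hA.1.isSymmetric
  refine ⟨hs.eigenvectorBasis rfl, hs.eigenvalues rfl, fun k => ?_, fun k =>
    hs.apply_eigenvectorBasis rfl k⟩
  have h1 : A (hs.eigenvectorBasis rfl k) = ((hs.eigenvalues rfl k : ℝ) : ℂ) •
    hs.eigenvectorBasis rfl k := hs.apply_eigenvectorBasis rfl k
  have h2 := hA.2 (hs.eigenvectorBasis rfl k) ((hs.eigenvectorBasis rfl).orthonormal.ne_zero k)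
  rw [h1, inner_smul_right, inner_self_eq_norm_sq_to_K] at h2
  simpa using h2

theorem IsPosDef.exists_inverse {A : H →L[ℂ] H} (hA : IsPosDef A) :
    ∃ B : H →L[ℂ] H, A * B = 1 := by
  have hi : Function.Injective (A : H →ₗ[ℂ] H) := by
    rw [injective_iff_map_eq_zero]
    intro x hx
    by_contra h0
    have := hA.2 x h0
    rw [show A x = 0 from hx] at this
    simp at this
  refine ⟨((LinearEquiv.ofInjectiveEndo _ hi).symm : H →ₗ[ℂ] H).toContinuousLinearMap, ?_⟩
  ext x
  exact (LinearEquiv.ofInjectiveEndo _ hi).apply_symm_apply x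

theorem opTrace_mul_eq_sum {ι : Type*} [Fintype ι] (b : OrthonormalBasis ι ℂ H) (r : ι → ℝ)
    {ρ : H →L[ℂ] H} (hb : ∀ k, ρ (b k) = (r k : ℂ) • b k) (A : H →L[ℂ] H) :
    opTrace (A * ρ) = ∑ k, (r k : ℂ) * ⟪b k, A (b k)⟫_ℂ := by
  rw [opTrace_eq_sum_inner b]
  refine Finset.sum_congr rfl fun k _ => ?_
  rw [mul_apply_eq_comp, hb, map_smul, inner_smul_right]

/-- The trace pairing of a positive-definite operator with an operator whose numerical range lies
in the open right half-plane. -/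
theorem re_opTrace_mul_pos [Nontrivial H] {A ρ : H →L[ℂ] H} (hρ : IsPosDef ρ)
    (hA : ∀ x : H, x ≠ 0 → 0 < (⟪x, A x⟫_ℂ).re) : 0 < (opTrace (A * ρ)).re := by
  obtain ⟨b, r, hr, hb⟩ := hρ.exists_eigenbasis
  rw [opTrace_mul_eq_sum b r hb, Complex.re_sum]
  have : Nonempty (Fin (Module.finrank ℂ H)) := ⟨⟨0, Module.finrank_pos⟩⟩
  refine Finset.sum_pos (fun k _ => ?_) Finset.univ_nonempty
  rw [Complex.re_ofReal_mul]
  exact mul_pos (hr k) (hA _ (b.orthonormal.ne_zero k))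

theorem IsPosDef.exists_opTrace_mul [Nontrivial H] {A ρ : H →L[ℂ] H} (hA : IsPosDef A)
    (hρ : IsPosDef ρ) : ∃ t : ℝ, 0 < t ∧ opTrace (A * ρ) = t := by
  refine ⟨(opTrace (A * ρ)).re, re_opTrace_mul_pos hρ hA.2, ?_⟩
  obtain ⟨b, r, hr, hb⟩ := hρ.exists_eigenbasis
  apply Complex.ext
  · simp
  · rw [opTrace_mul_eq_sum b r hb, Complex.im_sum, Complex.ofReal_im]
    exact Finset.sum_eq_zero fun k _ => by rw [Complex.im_ofReal_mul, hA.im_inner, mul_zero]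

theorem IsPosDef.exists_opTrace [Nontrivial H] {A : H →L[ℂ] H} (hA : IsPosDef A) :
    ∃ t : ℝ, 0 < t ∧ opTrace A = t := by
  simpa using hA.exists_opTrace_mul isPosDef_one

/-- The form `S ↦ Tr (S^* ρ S J)` is positive definite when `ρ` and `J` are. -/
theorem opTrace_conj_nonneg {ρ J : H →L[ℂ] H} (hρ : IsPosDef ρ) (hJ : IsPosDef J)
    (S : H →L[ℂ] H) : 0 ≤ (opTrace (star S * ρ * S * J)).re ∧
      ((opTrace (star S * ρ * S * J)).re = 0 → S = 0) := by
  obtain ⟨b, r, hr, hb⟩ := hJ.exists_eigenbasis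
  have hin : ∀ k, ⟪b k, (star S * ρ * S) (b k)⟫_ℂ = ⟪S (b k), ρ (S (b k))⟫_ℂ := fun k => by
    rw [mul_apply_eq_comp, mul_apply_eq_comp,
      ContinuousLinearMap.star_eq_adjoint, ContinuousLinearMap.adjoint_inner_right]
  have hnn : ∀ k, 0 ≤ r k * (⟪S (b k), ρ (S (b k))⟫_ℂ).re := fun k =>
    mul_nonneg (hr k).le (re_inner_nonneg hρ.nonneg _)
  rw [opTrace_mul_eq_sum b r hb, Complex.re_sum]
  simp only [hin, Complex.re_ofReal_mul]
  refine ⟨Finset.sum_nonneg fun k _ => hnn k, fun h => ?_⟩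
  rw [Finset.sum_eq_zero_iff_of_nonneg fun k _ => hnn k] at h
  have : (S : H →ₗ[ℂ] H) = 0 := b.toBasis.ext fun k => by
    by_contra h0
    have h1 := hρ.2 (S (b k)) (by simpa using h0)
    have h2 := h k (Finset.mem_univ k)
    exact (mul_pos (hr k) h1).ne' h2
  ext x
  exact LinearMap.congr_fun this x

/-- A quadratic form with positive real part is coercive in finite dimension. -/
theorem exists_pos_forall_le_re_inner {A : H →L[ℂ] H}
    (hA : ∀ x : H, x ≠ 0 → 0 < (⟪x, A x⟫_ℂ).re) :
    ∃ δ : ℝ, 0 < δ ∧ ∀ x, δ * ‖x‖ ^ 2 ≤ (⟪x, A x⟫_ℂ).re := by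
  rcases subsingleton_or_nontrivial H with hH | hH
  · exact ⟨1, one_pos, fun x => by simp [Subsingleton.elim x 0]⟩
  have : ProperSpace H := FiniteDimensional.proper ℂ H
  have hc : Continuous fun x : H => (⟪x, A x⟫_ℂ).re := by fun_prop
  obtain ⟨y, hy⟩ := exists_ne (0 : H)
  have hne : (Metric.sphere (0 : H) 1).Nonempty :=
    ⟨((‖y‖⁻¹ : ℝ) : ℂ) • y, by simp [norm_smul, hy]⟩
  obtain ⟨x₀, hx₀, hmin⟩ := (isCompact_sphere (0 : H) 1).exists_isMinOn hne hc.continuousOn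
  refine ⟨_, hA x₀ (by rintro rfl; simp at hx₀), fun x => ?_⟩
  rcases eq_or_ne x 0 with rfl | hx
  · simp
  have h1 := hmin (show ((‖x‖⁻¹ : ℝ) : ℂ) • x ∈ Metric.sphere (0 : H) 1 by
    simp [norm_smul, hx])
  have hx' : 0 < ‖x‖ := norm_pos_iff.2 hx
  have h2 : (⟪((‖x‖⁻¹ : ℝ) : ℂ) • x, A (((‖x‖⁻¹ : ℝ) : ℂ) • x)⟫_ℂ).re
      = (⟪x, A x⟫_ℂ).re / ‖x‖ ^ 2 := by
    rw [map_smul, inner_smul_left, inner_smul_right, Complex.conj_ofReal, ← mul_assoc,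
      ← Complex.ofReal_mul, Complex.re_ofReal_mul]
    field_simp
  simp only [Set.mem_ofPred_eq, h2] at h1
  exact (le_div_iff₀ (by positivity)).1 h1

theorem isOpen_setOf_re_inner_pos :
    IsOpen {A : H →L[ℂ] H | ∀ x : H, x ≠ 0 → 0 < (⟪x, A x⟫_ℂ).re} := by
  rw [Metric.isOpen_iff]
  intro A hA
  obtain ⟨δ, hδ, h⟩ := exists_pos_forall_le_re_inner hA
  refine ⟨δ, hδ, fun B hB x hx => ?_⟩
  have hx' : 0 < ‖x‖ := norm_pos_iff.2 hx
  have h1 : ‖⟪x, (B - A) x⟫_ℂ‖ ≤ ‖x‖ * (‖B - A‖ * ‖x‖) :=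
    (norm_inner_le_norm _ _).trans (by gcongr; exact (B - A).le_opNorm x)
  have h2 : ‖B - A‖ < δ := by rwa [← dist_eq_norm]
  have h3 := (abs_le.1 ((Complex.abs_re_le_norm _).trans h1)).1
  have h4 : ⟪x, B x⟫_ℂ = ⟪x, A x⟫_ℂ + ⟪x, (B - A) x⟫_ℂ := by
    rw [sub_apply, inner_sub_right]; ring
  rw [h4, Complex.add_re]
  have := h x
  nlinarith [mul_pos hx' hx']

/-! ### Irreducible families and positivity improvement -/

/-- The only subspaces invariant under all the `W i` are `{0}` and the whole space; no
normalization of the family is assumed. -/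
def IsIrreducibleFamily (W : I → H →L[ℂ] H) : Prop :=
  ∀ E : Submodule ℂ H, (∀ i, ∀ x ∈ E, W i x ∈ E) → E = ⊥ ∨ E = ⊤

theorem krausMap_apply (W : I → H →L[ℂ] H) (X : H →L[ℂ] H) :
    krausMap W X = ∑ i, W i * X * star (W i) := by
  simp [krausMap, sandwich, mul_assoc]

theorem krausMap_nonneg (W : I → H →L[ℂ] H) {X : H →L[ℂ] H} (hX : 0 ≤ X) :
    0 ≤ krausMap W X := by
  rw [krausMap_apply]
  exact Finset.sum_nonneg fun i _ => star_right_conjugate_nonneg hX (W i)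

theorem krausMap_star (W : I → H →L[ℂ] H) (X : H →L[ℂ] H) :
    krausMap W (star X) = star (krausMap W X) := by
  simp [krausMap_apply, mul_assoc]

/-- `krausMap (star W)` is the trace dual of `krausMap W`. -/
theorem opTrace_krausMap_mul (W : I → H →L[ℂ] H) (X Y : H →L[ℂ] H) :
    opTrace (krausMap W X * Y) = opTrace (X * krausMap (star W) Y) := by
  have := opTrace_deformedMap_mul W (fun _ => 1) 0 X Y
  rwa [deformedMap_zero, show deformedDual W (fun _ => 1) 0 = krausMap (star W) by
    simp [deformedDual, krausMap]] at this

/-- Irreducibility passes to the adjoint family, by taking orthogonal complements. -/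
theorem IsIrreducibleFamily.star {W : I → H →L[ℂ] H} (hW : IsIrreducibleFamily W) :
    IsIrreducibleFamily (star W) := by
  intro E hE
  have h : ∀ i, ∀ x ∈ Eᗮ, W i x ∈ Eᗮ := fun i x hx => by
    rw [Submodule.mem_orthogonal] at hx ⊢
    intro y hy
    rw [← ContinuousLinearMap.adjoint_inner_left]
    exact hx _ (hE i y hy)
  rcases hW _ h with h | h
  · exact Or.inr ((Submodule.orthogonal_eq_bot_iff).1 h)
  · exact Or.inl ((Submodule.orthogonal_eq_top_iff E).1 h)

/-- Schur's lemma. -/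
theorem IsIrreducibleFamily.exists_eq_smul_one [Nontrivial H] {W : I → H →L[ℂ] H}
    (hW : IsIrreducibleFamily W) {S : H →L[ℂ] H} (hS : ∀ i, S * W i = W i * S) :
    ∃ c : ℂ, S = c • 1 := by
  obtain ⟨c, hc⟩ := Module.End.exists_eigenvalue (S : H →ₗ[ℂ] H)
  refine ⟨c, ?_⟩
  rcases hW (Module.End.eigenspace (S : H →ₗ[ℂ] H) c) (fun i x hx => by
    rw [Module.End.mem_eigenspace_iff] at hx ⊢
    have h1 : S (W i x) = W i (S x) := DFunLike.congr_fun (hS i) x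
    have h2 : S x = c • x := hx
    change S (W i x) = _
    rw [h1, h2, map_smul]) with h | h
  · exact (hc h).elim
  · ext x
    have : x ∈ Module.End.eigenspace (S : H →ₗ[ℂ] H) c := h ▸ Submodule.mem_top
    simpa using Module.End.mem_eigenspace_iff.1 this

theorem le_pow_one_add_krausMap (W : I → H →L[ℂ] H) {X : H →L[ℂ] H} (hX : 0 ≤ X) (N : ℕ) :
    X ≤ ((1 + krausMap W) ^ N) X := by
  induction N with
  | zero => simp
  | succ N ih =>
    rw [pow_succ', Module.End.mul_apply, LinearMap.add_apply, Module.End.one_apply]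
    exact ih.trans (le_add_of_nonneg_right (krausMap_nonneg W (hX.trans ih)))

/-- Iterating `1 + Φ` makes a nonzero positive semidefinite operator definite: the kernel of
`X + Φ(X)` is contained in that of `X`, and if they agree then it is invariant under the adjoint
family. -/
theorem IsIrreducibleFamily.exists_isPosDef_pow {W : I → H →L[ℂ] H}
    (hW : IsIrreducibleFamily W) {X : H →L[ℂ] H} (hX : 0 ≤ X) (hX0 : X ≠ 0) :
    ∃ N : ℕ, IsPosDef (((1 + krausMap W) ^ N) X) := by
  induction hn : Module.finrank ℂ (LinearMap.ker (X : H →ₗ[ℂ] H)) using Nat.strong_induction_on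
    generalizing X with
  | _ n ih =>
  by_cases hbot : LinearMap.ker (X : H →ₗ[ℂ] H) = ⊥
  · refine ⟨0, isPosDef_of_nonneg (by simpa using hX) fun x hx => ?_⟩
    have : x ∈ LinearMap.ker (X : H →ₗ[ℂ] H) := by simpa using hx
    rwa [hbot, Submodule.mem_bot] at this
  have hterm : ∀ i, 0 ≤ W i * X * Star.star (W i) := fun i => star_right_conjugate_nonneg hX (W i)
  have hΦ := krausMap_nonneg W hX
  have hle : LinearMap.ker ((X + krausMap W X : H →L[ℂ] H) : H →ₗ[ℂ] H) ≤
      LinearMap.ker (X : H →ₗ[ℂ] H) := fun x hx => by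
    have hx' : X x + krausMap W X x = 0 := by simpa using hx
    have h1 : (⟪x, X x⟫_ℂ).re + (⟪x, krausMap W X x⟫_ℂ).re = 0 := by
      rw [← Complex.add_re, ← inner_add_right, hx', inner_zero_right, Complex.zero_re]
    have h2 := re_inner_nonneg hX x
    have h3 := re_inner_nonneg hΦ x
    exact apply_eq_zero_of_re_inner_eq_zero hX (by linarith)
  have hne : LinearMap.ker ((X + krausMap W X : H →L[ℂ] H) : H →ₗ[ℂ] H) ≠
      LinearMap.ker (X : H →ₗ[ℂ] H) := fun heq => by
    rcases hW.star (LinearMap.ker (X : H →ₗ[ℂ] H)) (fun i x hx => by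
      have h1 : X x = 0 := hx
      have h2 : X x + krausMap W X x = 0 := by rw [← heq] at hx; simpa using hx
      rw [h1, zero_add] at h2
      have h3 : ∑ j, (⟪x, (W j * X * Star.star (W j)) x⟫_ℂ).re = 0 := by
        rw [← Complex.re_sum, ← inner_sum, ← sum_apply, ← krausMap_apply, h2,
          inner_zero_right, Complex.zero_re]
      have h4 := (Finset.sum_eq_zero_iff_of_nonneg
        fun j _ => re_inner_nonneg (hterm j) x).1 h3 i (Finset.mem_univ i)
      refine apply_eq_zero_of_re_inner_eq_zero hX ?_
      rw [← h4, mul_apply_eq_comp, mul_apply_eq_comp, Pi.star_apply,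
        ContinuousLinearMap.star_eq_adjoint, ContinuousLinearMap.adjoint_inner_left]) with h | h
    · exact hbot h
    · exact hX0 (ContinuousLinearMap.coe_inj.1 (by simpa using LinearMap.ker_eq_top.1 h))
  have h0 : X + krausMap W X ≠ 0 := fun h => hX0
    (le_antisymm (h ▸ le_add_of_nonneg_right hΦ) hX)
  obtain ⟨N, hN⟩ := ih _ (hn ▸ Submodule.finrank_lt_finrank_of_lt (lt_of_le_of_ne hle hne))
    (add_nonneg hX hΦ) h0 rfl
  exact ⟨N + 1, by rwa [pow_succ, Module.End.mul_apply]⟩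

/-! ### Existence of Perron eigenvectors -/

theorem IsPosDef.ne_zero [Nontrivial H] {A : H →L[ℂ] H} (hA : IsPosDef A) : A ≠ 0 := by
  rintro rfl
  obtain ⟨x, hx⟩ := exists_ne (0 : H)
  simpa using hA.2 x hx

/-- A positive-definite operator dominates a small multiple of any self-adjoint one. -/
theorem IsPosDef.exists_pos_smul_le {D X : H →L[ℂ] H} (hD : IsPosDef D) (hX : IsSelfAdjoint X) :
    ∃ ε : ℝ, 0 < ε ∧ (ε : ℂ) • X ≤ D := by
  have hc : ContinuousAt (fun ε : ℝ => D - (ε : ℂ) • X) 0 := by fun_prop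
  have h0 : D - ((0 : ℝ) : ℂ) • X ∈ {A : H →L[ℂ] H | ∀ x : H, x ≠ 0 → 0 < (⟪x, A x⟫_ℂ).re} := by
    simpa using hD.2
  have h1 := hc.eventually_mem (isOpen_setOf_re_inner_pos.mem_nhds h0)
  obtain ⟨ε, h2, hε⟩ := ((h1.filter_mono nhdsWithin_le_nhds).and
    (self_mem_nhdsWithin (s := Set.Ioi (0 : ℝ)))).exists
  refine ⟨ε, hε, sub_nonneg.1 (IsPosDef.nonneg ⟨?_, h2⟩)⟩
  refine hD.1.sub ?_
  rw [isSelfAdjoint_iff, star_smul, hX.star_eq]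
  simp

/-- Perron–Frobenius existence for irreducible completely positive maps, with the
Collatz–Wielandt argument: for a pair `(t, X)` with `X ≥ 0` of norm one, `Φ(X) ≥ t X` and `t`
maximal, the difference `Φ(X) - t X` vanishes, because otherwise an iterate of `1 + Φ` would make
it definite and `t` could be increased. -/
theorem IsIrreducibleFamily.exists_perron [Nontrivial H] {W : I → H →L[ℂ] H}
    (hW : IsIrreducibleFamily W) :
    ∃ (t : ℝ) (ρ : H →L[ℂ] H), 0 ≤ t ∧ IsPosDef ρ ∧ krausMap W ρ = (t : ℂ) • ρ := by
  have : ProperSpace (H →L[ℂ] H) := FiniteDimensional.proper ℂ _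
  have hΦc : Continuous (krausMap W) := LinearMap.continuous_of_finiteDimensional _
  set M := ‖LinearMap.toContinuousLinearMap (krausMap W)‖ with hM
  let C : Set (ℝ × (H →L[ℂ] H)) := (Set.Icc 0 M ×ˢ Metric.sphere 0 1) ∩
    {p | 0 ≤ p.2 ∧ (p.1 : ℂ) • p.2 ≤ krausMap W p.2}
  have hcompact : IsCompact C := by
    refine (isCompact_Icc.prod (isCompact_sphere _ _)).inter_right ?_
    refine IsClosed.and ?_ ?_
    · exact isClosed_le continuous_const continuous_snd
    · exact isClosed_le (by fun_prop) (by fun_prop)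
  -- `t X ≤ Φ(X)` gives `t ‖X‖ ≤ ‖Φ‖ ‖X‖`, so the bound `t ≤ M` in `C` is no restriction.
  have hbound : ∀ (t : ℝ) (X : H →L[ℂ] H), 0 ≤ t → 0 ≤ X → X ≠ 0 →
      (t : ℂ) • X ≤ krausMap W X → t ≤ M := fun t X ht hX hX0 h => by
    have h1 : 0 ≤ (t : ℂ) • X := by
      rw [Complex.coe_smul]; exact smul_nonneg ht hX
    have h2 := CStarAlgebra.norm_le_norm_of_nonneg_of_le h1 h
    have h3 : ‖krausMap W X‖ ≤ M * ‖X‖ :=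
      (LinearMap.toContinuousLinearMap (krausMap W)).le_opNorm X
    rw [norm_smul, Complex.norm_real, Real.norm_of_nonneg ht] at h2
    exact le_of_mul_le_mul_right (h2.trans h3) (norm_pos_iff.2 hX0)
  have hmem : ∀ (t : ℝ) (X : H →L[ℂ] H), 0 ≤ t → 0 ≤ X → X ≠ 0 →
      (t : ℂ) • X ≤ krausMap W X → ∃ Y, (t, Y) ∈ C := fun t X ht hX hX0 h => by
    have hn : 0 < ‖X‖ := norm_pos_iff.2 hX0
    refine ⟨‖X‖⁻¹ • X, ⟨⟨ht, hbound t X ht hX hX0 h⟩, ?_⟩, smul_nonneg (by positivity) hX, ?_⟩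
    · simp [norm_smul, hn.ne']
    · change (t : ℂ) • (‖X‖⁻¹ • X) ≤ krausMap W (‖X‖⁻¹ • X)
      have h1 : krausMap W (‖X‖⁻¹ • X) = ‖X‖⁻¹ • krausMap W X := by
        rw [← Complex.coe_smul, map_smul, Complex.coe_smul]
      rw [h1, smul_comm]
      exact smul_le_smul_of_nonneg_left h (by positivity)
  have hne : C.Nonempty := by
    obtain ⟨Y, hY⟩ := hmem 0 1 le_rfl zero_le_one one_ne_zero (by
      simpa using krausMap_nonneg W zero_le_one)
    exact ⟨_, hY⟩
  obtain ⟨⟨t, X⟩, ⟨⟨⟨ht, -⟩, hX1⟩, hX, htX⟩, hmax⟩ :=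
    hcompact.exists_isMaxOn hne continuous_fst.continuousOn
  simp only at ht hX1 hX htX
  have hX0 : X ≠ 0 := by rintro rfl; simp at hX1
  have heig : krausMap W X = (t : ℂ) • X := by
    by_contra hD0
    -- `X' = (1 + Φ)^N X` has `Φ(X') - t X' = (1 + Φ)^N (Φ(X) - t X)` positive definite.
    obtain ⟨N, hN⟩ := hW.exists_isPosDef_pow (sub_nonneg.2 htX) (sub_ne_zero.2 hD0)
    set X' := ((1 + krausMap W) ^ N) X with hX'
    have hcomm : krausMap W X' = ((1 + krausMap W) ^ N) (krausMap W X) := by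
      have : Commute (krausMap W) ((1 + krausMap W) ^ N) :=
        ((Commute.one_right _).add_right (Commute.refl _)).pow_right N
      exact LinearMap.congr_fun this.eq X
    rw [map_sub, map_smul, ← hcomm, ← hX'] at hN
    have hle := le_pow_one_add_krausMap W hX N
    have hX'0 : 0 ≤ X' := hX.trans hle
    obtain ⟨ε, hε, hle'⟩ := hN.exists_pos_smul_le (IsSelfAdjoint.of_nonneg hX'0)
    obtain ⟨Y, hY⟩ := hmem (t + ε) X' (by positivity) hX'0
      (fun h => hX0 (le_antisymm (h ▸ hle) hX)) (by
        rw [Complex.ofReal_add, add_smul, add_comm]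
        exact le_sub_iff_add_le.1 hle')
    have := hmax hY
    simp only [Set.mem_ofPred_eq] at this
    linarith
  -- On the eigenvector `X`, powers of `1 + Φ` are scalars, so `X` itself is definite.
  obtain ⟨N, hN⟩ := hW.exists_isPosDef_pow hX hX0
  have hpow : ∀ n : ℕ, ((1 + krausMap W) ^ n) X = ((1 + t : ℝ) ^ n : ℂ) • X := fun n => by
    induction n with
    | zero => simp
    | succ n ih =>
      rw [pow_succ', Module.End.mul_apply, ih, map_smul, LinearMap.add_apply,
        Module.End.one_apply, heig, pow_succ]
      push_cast
      module
  rw [hpow] at hN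
  have hpos : 0 < ((1 + t) ^ N)⁻¹ := by positivity
  have := hN.smul hpos
  rw [smul_smul, Complex.ofReal_inv, Complex.ofReal_pow, inv_mul_cancel₀ (by
    exact_mod_cast (show (1 + t) ^ N ≠ 0 by positivity)), one_smul] at this
  exact ⟨t, X, ht, this, heig⟩

/-! ### Twists of a Kraus family and rigidity of peripheral eigenvectors -/

/-- `S` intertwines the adjoint family with itself up to the scalar `c`, that is,
`S (W i)^* = c (W i)^* S` for all `i`. -/
def IsTwist (W : I → H →L[ℂ] H) (c : ℂ) (S : H →L[ℂ] H) : Prop :=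
  ∀ i, S * star (W i) = c • (star (W i) * S)

theorem IsTwist.krausMap_mul {W : I → H →L[ℂ] H} {c : ℂ} {S : H →L[ℂ] H} (h : IsTwist W c S)
    (X : H →L[ℂ] H) : krausMap W (X * S) = c • (krausMap W X * S) := by
  rw [krausMap_apply, krausMap_apply, Finset.sum_mul, Finset.smul_sum]
  refine Finset.sum_congr rfl fun i _ => ?_
  rw [mul_assoc, mul_assoc, h i]
  simp only [mul_smul_comm, mul_assoc]

theorem IsTwist.smul_family {W : I → H →L[ℂ] H} {c : ℂ} {S : H →L[ℂ] H} (h : IsTwist W c S)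
    (a : I → ℂ) : IsTwist (fun i => a i • W i) c S := fun i => by
  rw [star_smul, mul_smul_comm, smul_mul_assoc, h i, smul_comm]

theorem IsTwist.of_smul_family {W : I → H →L[ℂ] H} {c : ℂ} {S : H →L[ℂ] H} {a : I → ℂ}
    (ha : ∀ i, a i ≠ 0) (h : IsTwist (fun i => a i • W i) c S) : IsTwist W c S := by
  simpa [smul_smul, ha] using h.smul_family fun i => (a i)⁻¹

theorem IsTwist.pow {W : I → H →L[ℂ] H} {c : ℂ} {S : H →L[ℂ] H} (h : IsTwist W c S) (m : ℕ) :
    IsTwist W (c ^ m) (S ^ m) := by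
  induction m with
  | zero => intro i; simp
  | succ m ih =>
    intro i
    rw [pow_succ', mul_assoc, ih i, mul_smul_comm, ← mul_assoc, h i, smul_mul_assoc, smul_smul,
      mul_assoc, ← pow_succ]

theorem IsTwist.inv {W : I → H →L[ℂ] H} {c : ℂ} {S T : H →L[ℂ] H} (hc : c ≠ 0)
    (hTS : T * S = 1) (hST : S * T = 1) (h : IsTwist W c S) : IsTwist W c⁻¹ T := fun i => by
  have h1 : T * (S * star (W i)) * T = c • (T * (star (W i) * S) * T) := by
    rw [h i, mul_smul_comm, smul_mul_assoc]
  rw [← mul_assoc T S, hTS, one_mul, mul_assoc T, mul_assoc _ S, hST, mul_one] at h1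
  rw [h1, smul_smul, inv_mul_cancel₀ hc, one_smul]

/-- A twist by a unitary and a phase gives a twist of the adjoint family by the inverse unitary
and the same phase. -/
theorem IsTwist.star_family {W : I → H →L[ℂ] H} {c : ℂ} (hc : ‖c‖ = 1)
    {u : unitary (H →L[ℂ] H)} (h : IsTwist W c (u : H →L[ℂ] H)) :
    IsTwist (star W) c ((u⁻¹ : unitary (H →L[ℂ] H)) : H →L[ℂ] H) := fun i => by
  have hc0 : c ≠ 0 := by rintro rfl; simp at hc
  have h1 := congrArg star (h i)
  rw [star_mul, star_smul, star_mul, star_star] at h1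
  have hcc : c * star c = 1 := by
    have := Complex.mul_conj c
    rw [Complex.normSq_eq_norm_sq, hc] at this
    simpa using this
  rw [← Unitary.star_eq_inv, Unitary.coe_star, Pi.star_apply, star_star, h1, smul_smul, hcc,
    one_smul]

/-- Positive-definite eigenvectors `ρ` of `Φ` and `J` of `Φ^*` for a common eigenvalue `t > 0`. -/
structure IsPerronTriple (W : I → H →L[ℂ] H) (t : ℝ) (ρ J : H →L[ℂ] H) : Prop where
  pos : 0 < t
  left : IsPosDef ρ
  right : IsPosDef J
  map_eq : krausMap W ρ = (t : ℂ) • ρ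
  dual_eq : krausMap (star W) J = (t : ℂ) • J

theorem IsPerronTriple.star {W : I → H →L[ℂ] H} {t : ℝ} {ρ J : H →L[ℂ] H}
    (h : IsPerronTriple W t ρ J) : IsPerronTriple (star W) t J ρ :=
  ⟨h.pos, h.right, h.left, h.dual_eq, by rw [star_star]; exact h.map_eq⟩

/-- The eigenvalues of positive-definite eigenvectors of `Φ` and of its dual agree. -/
theorem IsIrreducibleFamily.exists_perronTriple [Nontrivial H] {W : I → H →L[ℂ] H}
    (hW : IsIrreducibleFamily W) (h0 : ∃ i, W i ≠ 0) :
    ∃ (t : ℝ) (ρ J : H →L[ℂ] H), IsPerronTriple W t ρ J := by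
  obtain ⟨t, ρ, ht, hρ, h1⟩ := hW.exists_perron
  obtain ⟨s, J, -, hJ, h2⟩ := hW.star.exists_perron
  have h3 := opTrace_krausMap_mul W ρ J
  obtain ⟨r, hr, h4⟩ := hρ.exists_opTrace_mul hJ
  rw [h1, h2, smul_mul_assoc, mul_smul_comm, map_smul, map_smul, h4, smul_eq_mul, smul_eq_mul] at h3
  have hst : t = s := by
    have : (t * r) = s * r := by exact_mod_cast h3
    exact mul_right_cancel₀ hr.ne' this
  subst hst
  refine ⟨t, ρ, J, ht.lt_of_ne' ?_, hρ, hJ, h1, h2⟩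
  rintro rfl
  obtain ⟨i, hi⟩ := h0
  -- If `Φ(ρ) = 0`, then all the positive terms `W i ρ (W i)^*` vanish.
  have h5 : ∑ j, (opTrace (Star.star (Star.star (W j)) * ρ * Star.star (W j) * 1)).re = 0 := by
    simp only [mul_one, star_star]
    rw [← Complex.re_sum, ← map_sum, ← krausMap_apply, h1]
    simp
  have h6 := (Finset.sum_eq_zero_iff_of_nonneg fun j _ =>
    (opTrace_conj_nonneg hρ isPosDef_one _).1).1 h5 i (Finset.mem_univ i)
  exact hi (star_eq_zero.1 ((opTrace_conj_nonneg hρ isPosDef_one _).2 h6))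

namespace IsPerronTriple

variable {W : I → H →L[ℂ] H} {t : ℝ} {ρ J : H →L[ℂ] H}

/-- An eigenvector `ρ S` of `Φ` for the eigenvalue `μ` satisfies `|μ| ≤ t`, and if `|μ| = t` then
`S` intertwines the family up to the phase `c = μ / t`. With
`D i = S (W i)^* - c (W i)^* S`, the sum of the `(D i)^* ρ (D i)` is
`Φ(S^* ρ S) - (|μ|² / t) S^* ρ S`, and its pairing with `J` is nonnegative. -/
theorem norm_le_and_isTwist (h : IsPerronTriple W t ρ J) {S : H →L[ℂ] H} (hS : S ≠ 0) {μ : ℂ}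
    (hμ : krausMap W (ρ * S) = μ • (ρ * S)) :
    ‖μ‖ ≤ t ∧ (‖μ‖ = t → IsTwist W (μ / t) S) := by
  have ht := h.pos
  have ht' : (t : ℂ) ≠ 0 := by exact_mod_cast ht.ne'
  set c := μ / t with hc
  have hct : c * t = μ := div_mul_cancel₀ _ ht'
  set K := Star.star S * ρ * S with hK
  let D : I → H →L[ℂ] H := fun i => S * Star.star (W i) - c • (Star.star (W i) * S)
  have hμ' : krausMap W (Star.star S * ρ) = Star.star μ • (Star.star S * ρ) := by
    have h1 : Star.star S * ρ = Star.star (ρ * S) := by rw [star_mul, h.left.1.star_eq]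
    rw [h1, krausMap_star, hμ, star_smul]
  -- Expand, and recognize `Φ` of `S^* ρ S`, `S^* ρ`, `ρ S` and `ρ` in the four terms.
  have hterm : ∀ i, Star.star (D i) * ρ * D i = W i * K * Star.star (W i)
      - c • (W i * (Star.star S * ρ) * Star.star (W i) * S)
      - Star.star c • (Star.star S * (W i * (ρ * S) * Star.star (W i)))
      + (c * Star.star c) • (Star.star S * (W i * ρ * Star.star (W i)) * S) := fun i => by
    simp only [D, hK, star_sub, star_mul, star_star, star_smul, sub_mul, mul_sub, smul_mul_assoc,
      mul_smul_comm, mul_assoc, smul_sub, smul_smul, mul_comm c]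
    abel
  have hsum : ∑ i, Star.star (D i) * ρ * D i = krausMap W K - (c * Star.star c * t) • K := by
    simp only [hterm, Finset.sum_add_distrib, Finset.sum_sub_distrib, ← Finset.smul_sum,
      ← Finset.sum_mul, ← Finset.mul_sum, ← krausMap_apply]
    rw [hμ, hμ', h.map_eq, ← hct, star_mul']
    simp only [smul_mul_assoc, mul_smul_comm, smul_smul, ← mul_assoc, ← hK, Complex.star_def,
      Complex.conj_ofReal]
    module
  have hcc : c * Star.star c = ((‖c‖ ^ 2 : ℝ) : ℂ) := by
    rw [Complex.star_def, Complex.mul_conj, Complex.normSq_eq_norm_sq]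
  have hnn : ∀ i, 0 ≤ (opTrace (Star.star (D i) * ρ * D i * J)).re := fun i =>
    (opTrace_conj_nonneg h.left h.right _).1
  have htr : ∑ i, (opTrace (Star.star (D i) * ρ * D i * J)).re
      = t * (1 - ‖c‖ ^ 2) * (opTrace (K * J)).re := by
    rw [← Complex.re_sum, ← map_sum, ← Finset.sum_mul, hsum, sub_mul, map_sub, opTrace_krausMap_mul,
      h.dual_eq, mul_smul_comm, smul_mul_assoc, map_smul, map_smul, hcc, ← sub_smul, smul_eq_mul,
      ← Complex.ofReal_mul, ← Complex.ofReal_sub, Complex.re_ofReal_mul]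
    ring
  have hKpos : 0 < (opTrace (K * J)).re :=
    (opTrace_conj_nonneg h.left h.right S).1.lt_of_ne fun h0 =>
      hS ((opTrace_conj_nonneg h.left h.right S).2 h0.symm)
  have hnorm : ‖μ‖ = ‖c‖ * t := by
    rw [← hct, norm_mul, Complex.norm_real, Real.norm_of_nonneg ht.le]
  have h1 : 0 ≤ t * (1 - ‖c‖ ^ 2) * (opTrace (K * J)).re :=
    htr ▸ Finset.sum_nonneg fun i _ => hnn i
  constructor
  · have h2 : 0 ≤ 1 - ‖c‖ ^ 2 := by
      by_contra hneg
      push Not at hneg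
      exact absurd h1 (not_le.2 (mul_neg_of_neg_of_pos (mul_neg_of_pos_of_neg ht hneg) hKpos))
    have h3 : ‖c‖ ≤ 1 := by nlinarith [norm_nonneg c]
    rw [hnorm]
    nlinarith
  · intro hμt i
    have h2 : ‖c‖ = 1 := mul_right_cancel₀ ht.ne' (by rw [← hnorm, hμt, one_mul])
    rw [h2, one_pow, sub_self, mul_zero, zero_mul] at htr
    have h3 := (Finset.sum_eq_zero_iff_of_nonneg fun i _ => hnn i).1 htr i (Finset.mem_univ i)
    exact sub_eq_zero.1 ((opTrace_conj_nonneg h.left h.right (D i)).2 h3)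

/-- Division by `ρ`: every operator is of the form `ρ S`. -/
theorem exists_eq_mul (h : IsPerronTriple W t ρ J) (X : H →L[ℂ] H) : ∃ S, X = ρ * S := by
  obtain ⟨B, hB⟩ := h.left.exists_inverse
  exact ⟨B * X, by rw [← mul_assoc, hB, one_mul]⟩

theorem eigenspace_eq [Nontrivial H] (h : IsPerronTriple W t ρ J) (hW : IsIrreducibleFamily W) :
    Module.End.eigenspace (krausMap W) (t : ℂ) = Submodule.span ℂ {ρ} := by
  refine le_antisymm (fun X hX => ?_) ?_
  · rw [Module.End.mem_eigenspace_iff] at hX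
    obtain ⟨S, rfl⟩ := h.exists_eq_mul X
    rcases eq_or_ne S 0 with rfl | hS
    · simp
    have h1 := (h.norm_le_and_isTwist hS hX).2
      (by rw [Complex.norm_real, Real.norm_of_nonneg h.pos.le])
    rw [div_self (by exact_mod_cast h.pos.ne')] at h1
    obtain ⟨c, rfl⟩ := hW.star.exists_eq_smul_one (S := S) fun i => by simpa using h1 i
    rw [mul_smul_comm, mul_one]
    exact Submodule.smul_mem _ _ (Submodule.mem_span_singleton_self ρ)
  · rw [Submodule.span_singleton_le_iff_mem, Module.End.mem_eigenspace_iff]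
    exact h.map_eq

theorem peripheralSpectrum_eq [Nontrivial H] (h : IsPerronTriple W t ρ J) :
    peripheralSpectrum (krausMap W) =
      {μ | (krausMap W).HasEigenvalue μ ∧ ‖μ‖ = t} := by
  have hbound : ∀ μ, (krausMap W).HasEigenvalue μ → ‖μ‖ ≤ t := fun μ hμ => by
    obtain ⟨X, hX⟩ := hμ.exists_hasEigenvector
    obtain ⟨S, rfl⟩ := h.exists_eq_mul X
    exact (h.norm_le_and_isTwist (right_ne_zero_of_mul hX.2) hX.apply_eq_smul).1
  have ht : (krausMap W).HasEigenvalue (t : ℂ) :=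
    Module.End.hasEigenvalue_of_hasEigenvector
      ⟨Module.End.mem_eigenspace_iff.2 h.map_eq, h.left.ne_zero⟩
  have hrad : spectralRadius ℂ (krausMap W) = ((‖(t : ℂ)‖₊ : NNReal) : ENNReal) := by
    refine le_antisymm (iSup₂_le fun μ hμ => ?_) ?_
    · have := hbound μ (Module.End.hasEigenvalue_iff_mem_spectrum.2 hμ)
      rw [ENNReal.coe_le_coe, ← NNReal.coe_le_coe, coe_nnnorm, coe_nnnorm, Complex.norm_real,
        Real.norm_of_nonneg h.pos.le]
      exact this
    · exact le_iSup₂ (f := fun μ (_ : μ ∈ spectrum ℂ (krausMap W)) => (‖μ‖₊ : ENNReal)) (t : ℂ)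
        (Module.End.hasEigenvalue_iff_mem_spectrum.1 ht)
  ext μ
  rw [peripheralSpectrum, Set.mem_ofPred_eq, Set.mem_ofPred_eq, hrad, ENNReal.coe_inj,
    ← Module.End.hasEigenvalue_iff_mem_spectrum, ← NNReal.coe_inj, coe_nnnorm, coe_nnnorm,
    Complex.norm_real, Real.norm_of_nonneg h.pos.le]

/-- Right multiplication by a twisting unitary permutes the eigenspaces of `Φ`. -/
theorem eigenspace_mul_eq [Nontrivial H] (h : IsPerronTriple W t ρ J)
    (hW : IsIrreducibleFamily W) {c : ℂ} (hc : c ≠ 0) {u : unitary (H →L[ℂ] H)}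
    (hu : IsTwist W c (u : H →L[ℂ] H)) :
    Module.End.eigenspace (krausMap W) ((t : ℂ) * c) =
      Submodule.span ℂ {ρ * (u : H →L[ℂ] H)} := by
  refine le_antisymm (fun X hX => ?_) ?_
  · rw [Module.End.mem_eigenspace_iff] at hX
    have hinv : IsTwist W c⁻¹ (Star.star (u : H →L[ℂ] H)) := hu.inv hc (by simp) (by simp)
    have h1 : X * Star.star (u : H →L[ℂ] H) ∈ Module.End.eigenspace (krausMap W) (t : ℂ) := by
      rw [Module.End.mem_eigenspace_iff, hinv.krausMap_mul, hX, smul_mul_assoc, smul_smul,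
        mul_comm (t : ℂ), ← mul_assoc, inv_mul_cancel₀ hc, one_mul]
    rw [h.eigenspace_eq hW, Submodule.mem_span_singleton] at h1
    obtain ⟨a, ha⟩ := h1
    rw [Submodule.mem_span_singleton]
    refine ⟨a, ?_⟩
    rw [← smul_mul_assoc, ha, mul_assoc]
    simp
  · rw [Submodule.span_singleton_le_iff_mem, Module.End.mem_eigenspace_iff, hu.krausMap_mul,
      h.map_eq, smul_mul_assoc, smul_smul, mul_comm c]

/-- The Perron eigenvector is unique up to a scalar, so it commutes with every twisting unitary. -/
theorem commute [Nontrivial H] (h : IsPerronTriple W t ρ J) (hW : IsIrreducibleFamily W) {c : ℂ}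
    (hc : ‖c‖ = 1) {u : unitary (H →L[ℂ] H)} (hu : IsTwist W c (u : H →L[ℂ] H)) :
    Commute ρ (u : H →L[ℂ] H) := by
  have hc0 : c ≠ 0 := by rintro rfl; simp at hc
  set U : H →L[ℂ] H := (u : H →L[ℂ] H)
  have hUU : Star.star U * U = 1 := Unitary.star_mul_self_of_mem u.2
  have hUU' : U * Star.star U = 1 := Unitary.mul_star_self_of_mem u.2
  have hinv : IsTwist W c⁻¹ (Star.star U) := hu.inv hc0 hUU hUU'
  have h1 : krausMap W (U * ρ) = Star.star c⁻¹ • (U * krausMap W ρ) := by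
    have h2 : U * ρ = Star.star (ρ * Star.star U) := by
      rw [star_mul, star_star, h.left.1.star_eq]
    rw [h2, krausMap_star, hinv.krausMap_mul, h.map_eq, star_smul, star_mul, star_star, star_smul,
      h.left.1.star_eq]
    simp
  have hcc : c⁻¹ * Star.star c⁻¹ = 1 := by
    have := Complex.mul_conj c⁻¹
    rw [Complex.normSq_eq_norm_sq, norm_inv, hc] at this
    simpa using this
  -- `U ρ U^*` is a Perron eigenvector too, and it has the same trace as `ρ`.
  have h3 : U * ρ * Star.star U ∈ Module.End.eigenspace (krausMap W) (t : ℂ) := by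
    rw [Module.End.mem_eigenspace_iff, hinv.krausMap_mul, h1, h.map_eq, smul_mul_assoc, smul_smul,
      hcc, one_smul, mul_smul_comm, smul_mul_assoc]
  rw [h.eigenspace_eq hW, Submodule.mem_span_singleton] at h3
  obtain ⟨a, ha⟩ := h3
  obtain ⟨r, hr, hr'⟩ := h.left.exists_opTrace
  have h4 := congrArg opTrace ha
  rw [map_smul, opTrace_mul_comm, ← mul_assoc, hUU, one_mul, smul_eq_mul] at h4
  have ha1 : a = 1 := by
    have h5 : (r : ℂ) ≠ 0 := by exact_mod_cast hr.ne'
    rw [hr'] at h4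
    exact mul_right_cancel₀ h5 (by rw [h4, one_mul])
  rw [ha1, one_smul] at ha
  change ρ * U = U * ρ
  conv_lhs => rw [ha]
  rw [mul_assoc, hUU, mul_one]

end IsPerronTriple

/-- A simple eigenvalue with eigenvector `e` and dual eigenvector `f` normalized by `f e = 1` has
`η ↦ f η • e` as spectral projector: `f` kills the generalized eigenspaces of the other
eigenvalues and the image of `T - μ`. -/
theorem isSpectralProjector_smulRight {T : Module.End ℂ (H →L[ℂ] H)} {μ : ℂ}
    {f : (H →L[ℂ] H) →ₗ[ℂ] ℂ} {e : H →L[ℂ] H} (he : T.eigenspace μ = Submodule.span ℂ {e})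
    (hf : ∀ x, f (T x) = μ * f x) (hfe : f e = 1) :
    IsSpectralProjector T μ (f.smulRight e) := by
  have hTe : T e = μ • e :=
    Module.End.mem_eigenspace_iff.1 (he ▸ Submodule.mem_span_singleton_self e)
  have hfpow : ∀ (ν : ℂ) (k : ℕ) (x : H →L[ℂ] H),
      f (((T - algebraMap ℂ _ ν) ^ k) x) = (μ - ν) ^ k * f x := fun ν k => by
    induction k with
    | zero => simp
    | succ k ih =>
      intro x
      rw [pow_succ, Module.End.mul_apply, ih, LinearMap.sub_apply, map_sub, hf,
        Module.algebraMap_end_apply, map_smul, smul_eq_mul]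
      ring
  have hother : ⨆ ν : ℂ, ⨆ _ : ν ≠ μ, T.maxGenEigenspace ν ≤ LinearMap.ker f := by
    refine iSup₂_le fun ν hν x hx => ?_
    obtain ⟨k, hk⟩ := (Module.End.mem_maxGenEigenspace T ν x).1 hx
    have h1 := hfpow ν k x
    rw [Algebra.algebraMap_eq_smul_one, hk, map_zero] at h1
    exact (mul_eq_zero.1 h1.symm).resolve_left (pow_ne_zero _ (sub_ne_zero.2 hν.symm))
  -- Algebraic simplicity: if `(T - μ) x = a e`, then `a = f (a e) = f ((T - μ) x) = 0`.
  have hpow : ∀ (k : ℕ) (x : H →L[ℂ] H), ((T - μ • 1) ^ k) x = 0 → x ∈ Submodule.span ℂ {e} := by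
    intro k
    induction k with
    | zero => intro x hx; rw [pow_zero, Module.End.one_apply] at hx; simp [hx]
    | succ k ih =>
      intro x hx
      rw [pow_succ, Module.End.mul_apply] at hx
      obtain ⟨a, ha⟩ := Submodule.mem_span_singleton.1 (ih _ hx)
      have h1 : a = 0 := by
        have := congrArg f ha
        rw [map_smul, hfe, LinearMap.sub_apply, map_sub, hf, LinearMap.smul_apply,
          Module.End.one_apply, map_smul] at this
        simpa using this
      rw [h1, zero_smul] at ha
      rw [← he, Module.End.mem_eigenspace_iff, ← sub_eq_zero]
      exact ha.symm
  have hmax : T.maxGenEigenspace μ = Submodule.span ℂ {e} := by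
    refine le_antisymm (fun x hx => ?_) ?_
    · obtain ⟨k, hk⟩ := (Module.End.mem_maxGenEigenspace T μ x).1 hx
      exact hpow k x hk
    · rw [Submodule.span_singleton_le_iff_mem, Module.End.mem_maxGenEigenspace]
      exact ⟨1, by rw [pow_one, LinearMap.sub_apply, hTe, LinearMap.smul_apply,
        Module.End.one_apply, sub_self]⟩
  have he0 : e ≠ 0 := by rintro rfl; simp at hfe
  refine ⟨?_, ?_, ?_⟩
  · ext1 x
    rw [Module.End.mul_apply, LinearMap.smulRight_apply, LinearMap.smulRight_apply, map_smul, hfe,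
      smul_eq_mul, mul_one]
  · rw [hmax]
    refine le_antisymm ?_ ?_
    · rintro _ ⟨x, rfl⟩
      exact Submodule.smul_mem _ _ (Submodule.mem_span_singleton_self e)
    · rw [Submodule.span_singleton_le_iff_mem]
      exact ⟨e, by rw [LinearMap.smulRight_apply, hfe, one_smul]⟩
  · have hker : LinearMap.ker (f.smulRight e) = LinearMap.ker f := by
      ext x
      rw [LinearMap.mem_ker, LinearMap.mem_ker, LinearMap.smulRight_apply]
      exact ⟨fun hx => (smul_eq_zero.1 hx).resolve_right he0, fun hx => by rw [hx, zero_smul]⟩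
    rw [hker]
    refine le_antisymm (fun x hx => ?_) hother
    have htop : x ∈ T.maxGenEigenspace μ ⊔ ⨆ ν : ℂ, ⨆ _ : ν ≠ μ, T.maxGenEigenspace ν := by
      have h1 : (⊤ : Submodule ℂ (H →L[ℂ] H)) ≤
          T.maxGenEigenspace μ ⊔ ⨆ ν : ℂ, ⨆ _ : ν ≠ μ, T.maxGenEigenspace ν := by
        rw [← Module.End.iSup_maxGenEigenspace_eq_top T]
        refine iSup_le fun ν => ?_
        rcases eq_or_ne ν μ with rfl | hν
        · exact le_sup_left
        · exact le_sup_of_le_right (le_iSup₂_of_le ν hν le_rfl)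
      exact h1 Submodule.mem_top
    obtain ⟨y, hy, w, hw, rfl⟩ := Submodule.mem_sup.1 htop
    have hfw : f w = 0 := hother hw
    rw [hmax, Submodule.mem_span_singleton] at hy
    obtain ⟨a, rfl⟩ := hy
    rw [LinearMap.mem_ker, map_add, hfw, map_smul, hfe] at hx
    have ha : a = 0 := by simpa using hx
    rw [ha, zero_smul, zero_add]
    exact hw

/-! ### Deformed families and analytic dependence on the parameter -/

/-- The Kraus operators `√(v i ^ α) V i` of the deformation with parameter `α`. -/
def deformedFamily (V : I → H →L[ℂ] H) (v : I → ℝ) (α : ℝ) (i : I) : H →L[ℂ] H :=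
  ((√(v i ^ α) : ℝ) : ℂ) • V i

theorem star_deformedFamily (V : I → H →L[ℂ] H) (v : I → ℝ) (α : ℝ) :
    star (deformedFamily V v α) = deformedFamily (star V) v α := by
  ext1 i
  simp [deformedFamily]

theorem deformedMap_eq_krausMap (V : I → H →L[ℂ] H) {v : I → ℝ} (hv : ∀ i, 0 < v i) (α : ℝ) :
    deformedMap V v α = krausMap (deformedFamily V v α) := by
  ext1 X
  rw [krausMap_apply]
  simp only [deformedMap, sandwich, LinearMap.sum_apply, LinearMap.smul_apply,
    LinearMap.comp_apply, LinearMap.mulLeft_apply, LinearMap.mulRight_apply, deformedFamily]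
  refine Finset.sum_congr rfl fun i _ => ?_
  rw [star_smul, smul_mul_assoc, smul_mul_assoc, mul_smul_comm, smul_smul, Complex.star_def,
    Complex.conj_ofReal, ← Complex.ofReal_mul, Real.mul_self_sqrt (Real.rpow_pos_of_pos (hv i) α).le,
    mul_assoc]

theorem deformedDual_eq_deformedMap (V : I → H →L[ℂ] H) (v : I → ℝ) (α : ℝ) :
    deformedDual V v α = deformedMap (star V) v α := by
  simp [deformedDual, deformedMap]

theorem sqrt_rpow_ne_zero {v : I → ℝ} (hv : ∀ i, 0 < v i) (α : ℝ) (i : I) :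
    ((√(v i ^ α) : ℝ) : ℂ) ≠ 0 := by
  have := Real.sqrt_pos.2 (Real.rpow_pos_of_pos (hv i) α)
  exact_mod_cast this.ne'

theorem IsIrreducibleFamily.deformedFamily {V : I → H →L[ℂ] H} (hV : IsIrreducibleFamily V)
    {v : I → ℝ} (hv : ∀ i, 0 < v i) (α : ℝ) : IsIrreducibleFamily (deformedFamily V v α) := by
  intro E hE
  refine hV E fun i x hx => ?_
  have h1 := E.smul_mem ((√(v i ^ α) : ℝ) : ℂ)⁻¹ (hE i x hx)
  rwa [KrausDeformation.deformedFamily, smul_apply, smul_smul,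
    inv_mul_cancel₀ (sqrt_rpow_ne_zero hv α i), one_smul] at h1

theorem contDiff_deformedMap (V : I → H →L[ℂ] H) {v : I → ℝ} (hv : ∀ i, 0 < v i)
    {n : WithTop ℕ∞} :
    ContDiff ℝ n fun p : ℝ × (H →L[ℂ] H) => deformedMap V v p.1 p.2 := by
  simp only [deformedMap, LinearMap.sum_apply, LinearMap.smul_apply]
  refine ContDiff.sum fun i _ => ?_
  have h1 : ContDiff ℝ n fun p : ℝ × (H →L[ℂ] H) => ((v i ^ p.1 : ℝ) : ℂ) :=
    Complex.ofRealCLM.contDiff.comp (contDiff_const.rpow contDiff_fst fun _ => (hv i).ne')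
  have h2 : ContDiff ℝ n fun p : ℝ × (H →L[ℂ] H) => sandwich (V i) (star (V i)) p.2 :=
    ((LinearMap.toContinuousLinearMap
      (sandwich (V i) (star (V i)))).restrictScalars ℝ).contDiff.comp contDiff_snd
  exact h1.smul h2

theorem analyticOnNhd_opTrace {A : ℝ → (H →L[ℂ] H)} (hA : AnalyticOnNhd ℝ A Set.univ) :
    AnalyticOnNhd ℝ (fun α => opTrace (A α)) Set.univ :=
  ((LinearMap.toContinuousLinearMap (opTrace (H := H))).restrictScalars ℝ).comp_analyticOnNhd hA

theorem analyticOnNhd_deformedMap (V : I → H →L[ℂ] H) {v : I → ℝ} (hv : ∀ i, 0 < v i)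
    {A : ℝ → (H →L[ℂ] H)} (hA : AnalyticOnNhd ℝ A Set.univ) :
    AnalyticOnNhd ℝ (fun α => deformedMap V v α (A α)) Set.univ := by
  simp only [deformedMap, LinearMap.sum_apply, LinearMap.smul_apply]
  refine Finset.univ.analyticOnNhd_fun_sum fun i _ => ?_
  have h1 : AnalyticOnNhd ℝ (fun α : ℝ => ((v i ^ α : ℝ) : ℂ)) Set.univ := fun α _ =>
    (Complex.ofRealCLM.contDiff.comp
      (contDiff_const.rpow contDiff_id fun _ => (hv i).ne')).contDiffAt.analyticAt
  exact h1.smul (((LinearMap.toContinuousLinearMap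
    (sandwich (V i) (star (V i)))).restrictScalars ℝ).comp_analyticOnNhd hA)

/-- The equation `Φ(X) = Tr(Φ(X)) X` is nondegenerate at a trace-one Perron eigenvector: its
linearization is injective, as one sees by pairing with the dual eigenvector. -/
theorem IsPerronTriple.linearization_injective [Nontrivial H] {W : I → H →L[ℂ] H} {t : ℝ}
    {ρ J : H →L[ℂ] H} (h : IsPerronTriple W t ρ J) (hW : IsIrreducibleFamily W)
    (hρ : opTrace ρ = 1) {X : H →L[ℂ] H}
    (hX : krausMap W X = (t : ℂ) • X + opTrace (krausMap W X) • ρ) : X = 0 := by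
  have h1 := congrArg (fun Y => opTrace (Y * J)) hX
  simp only [add_mul, smul_mul_assoc, map_add, map_smul, smul_eq_mul] at h1
  rw [opTrace_krausMap_mul, h.dual_eq, mul_smul_comm, map_smul, smul_eq_mul, left_eq_add,
    mul_eq_zero] at h1
  obtain ⟨r, hr, hr'⟩ := h.left.exists_opTrace_mul h.right
  have h2 : opTrace (krausMap W X) = 0 := h1.resolve_right (by
    rw [hr']; exact_mod_cast hr.ne')
  rw [h2, zero_smul, add_zero] at hX
  have h3 : X ∈ Module.End.eigenspace (krausMap W) (t : ℂ) :=
    Module.End.mem_eigenspace_iff.2 hX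
  rw [h.eigenspace_eq hW, Submodule.mem_span_singleton] at h3
  obtain ⟨k, rfl⟩ := h3
  rw [hX, smul_smul, map_smul, hρ, smul_eq_mul, mul_one] at h2
  have h4 : k = 0 := (mul_eq_zero.1 h2).resolve_left (by exact_mod_cast h.pos.ne')
  rw [h4, zero_smul]

/-- A solution of `Φ(X) = Tr(Φ(X)) X` whose numerical range lies in the open right half-plane is
the trace-one Perron eigenvector. -/
theorem IsPerronTriple.eq_of_map_eq [Nontrivial H] {W : I → H →L[ℂ] H} {t : ℝ}
    {ρ J : H →L[ℂ] H} (h : IsPerronTriple W t ρ J) (hW : IsIrreducibleFamily W)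
    (hρ : opTrace ρ = 1) {X : H →L[ℂ] H} (hpos : ∀ x : H, x ≠ 0 → 0 < (⟪x, X x⟫_ℂ).re)
    (hX : krausMap W X = opTrace (krausMap W X) • X) : X = ρ := by
  have h0 : opTrace (X * J) ≠ 0 := fun h0 => by
    have := re_opTrace_mul_pos h.right hpos
    rw [h0] at this
    exact lt_irrefl _ this
  have h1 := congrArg (fun Y => opTrace (Y * J)) hX
  simp only [smul_mul_assoc, map_smul, smul_eq_mul] at h1
  rw [opTrace_krausMap_mul, h.dual_eq, mul_smul_comm, map_smul, smul_eq_mul] at h1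
  have h2 := mul_right_cancel₀ h0 h1
  rw [← h2] at hX
  have h3 : X ∈ Module.End.eigenspace (krausMap W) (t : ℂ) :=
    Module.End.mem_eigenspace_iff.2 hX
  rw [h.eigenspace_eq hW, Submodule.mem_span_singleton] at h3
  obtain ⟨k, rfl⟩ := h3
  rw [map_smul, h.map_eq, map_smul, map_smul, hρ, smul_eq_mul, smul_eq_mul, mul_one] at h2
  have h4 : k = 1 := mul_right_cancel₀ (b := (t : ℂ)) (by exact_mod_cast h.pos.ne')
    (by rw [← h2, one_mul])
  rw [h4, one_smul]

/-- The trace-one Perron eigenvector depends analytically on the deformation parameter: the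
implicit function theorem gives an analytic branch of solutions of `Φ(X) = Tr(Φ(X)) X`, which
stays in the open set where the real part is positive definite and so is the Perron branch. -/
theorem analyticOnNhd_perron [Nontrivial H] {V : I → H →L[ℂ] H} (hV : IsIrreducibleFamily V)
    {v : I → ℝ} (hv : ∀ i, 0 < v i) {t : ℝ → ℝ} {ρ J : ℝ → (H →L[ℂ] H)}
    (h : ∀ α, IsPerronTriple (deformedFamily V v α) (t α) (ρ α) (J α))
    (hρ : ∀ α, opTrace (ρ α) = 1) : AnalyticOnNhd ℝ ρ Set.univ := by
  intro α₀ _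
  let τ : (H →L[ℂ] H) →L[ℝ] ℂ := (LinearMap.toContinuousLinearMap opTrace).restrictScalars ℝ
  let A : (H →L[ℂ] H) →L[ℝ] (H →L[ℂ] H) :=
    (LinearMap.toContinuousLinearMap (deformedMap V v α₀)).restrictScalars ℝ
  have hA : ∀ X, A X = krausMap (deformedFamily V v α₀) X := fun X => by
    rw [← deformedMap_eq_krausMap V hv]; rfl
  let G : ℝ × (H →L[ℂ] H) → (H →L[ℂ] H) := fun p =>
    deformedMap V v p.1 p.2 - τ (deformedMap V v p.1 p.2) • p.2
  have hG : ContDiff ℝ (⊤ : WithTop ℕ∞) G := by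
    have h1 : ContDiff ℝ (⊤ : WithTop ℕ∞) fun p : ℝ × (H →L[ℂ] H) =>
        τ (deformedMap V v p.1 p.2) := τ.contDiff.comp (contDiff_deformedMap V hv)
    exact (contDiff_deformedMap V hv).sub (h1.smul contDiff_snd)
  have hGat : ContDiffAt ℝ (⊤ : WithTop ℕ∞) G (α₀, ρ α₀) := hG.contDiffAt
  have htop : (⊤ : WithTop ℕ∞) ≠ 0 := by simp
  have hG0 : ∀ α, G (α, ρ α) = 0 := fun α => by
    change deformedMap V v α (ρ α) - opTrace (deformedMap V v α (ρ α)) • ρ α = 0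
    rw [deformedMap_eq_krausMap V hv, (h α).map_eq, map_smul, hρ, smul_eq_mul, mul_one, sub_self]
  let D : (H →L[ℂ] H) →L[ℝ] (H →L[ℂ] H) :=
    A - (τ (A (ρ α₀)) • ContinuousLinearMap.id ℝ _ + (τ.comp A).smulRight (ρ α₀))
  have hD : fderiv ℝ G (α₀, ρ α₀) ∘L .inr ℝ ℝ (H →L[ℂ] H) = D := by
    have h1 := (hGat.differentiableAt htop).hasFDerivAt.comp (ρ α₀)
      (hasFDerivAt_prodMk_right (𝕜 := ℝ) α₀ (ρ α₀))
    refine h1.unique ?_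
    exact A.hasFDerivAt.sub (((τ.comp A).hasFDerivAt).smul (hasFDerivAt_id (𝕜 := ℝ) (ρ α₀)))
  have hDinj : Function.Injective (D : (H →L[ℂ] H) →ₗ[ℝ] (H →L[ℂ] H)) := by
    rw [injective_iff_map_eq_zero]
    intro X hX
    refine (h α₀).linearization_injective (hV.deformedFamily hv α₀) (hρ α₀) ?_
    have h2 : A X - (τ (A (ρ α₀)) • X + τ (A X) • ρ α₀) = 0 := hX
    have h3 : τ (A (ρ α₀)) = t α₀ := by
      rw [hA, (h α₀).map_eq]
      change opTrace _ = _
      rw [map_smul, hρ, smul_eq_mul, mul_one]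
    rw [h3, sub_eq_zero, hA] at h2
    exact h2
  have hinv : (fderiv ℝ G (α₀, ρ α₀) ∘L .inr ℝ ℝ (H →L[ℂ] H)).IsInvertible := by
    rw [hD]
    exact ⟨(LinearEquiv.ofInjectiveEndo _ hDinj).toContinuousLinearEquiv, by ext1 X; rfl⟩
  have hg := hGat.contDiffAt_implicitFunction htop hinv
  have hg0 := hGat.implicitFunction_apply_self htop hinv
  have hgG := hGat.eventually_apply_implicitFunction htop hinv
  set g := hGat.implicitFunction htop hinv
  simp only at hg hg0 hgG
  refine hg.analyticAt.congr ?_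
  have hopen : ∀ᶠ α in nhds α₀,
      g α ∈ {A : H →L[ℂ] H | ∀ x : H, x ≠ 0 → 0 < (⟪x, A x⟫_ℂ).re} :=
    hg.continuousAt.eventually_mem (isOpen_setOf_re_inner_pos.mem_nhds (by
      rw [hg0]; exact (h α₀).left.2))
  filter_upwards [hgG, hopen] with α h1 h2
  refine (h α).eq_of_map_eq (hV.deformedFamily hv α) (hρ α) h2 ?_
  rw [hG0 α₀] at h1
  rw [← deformedMap_eq_krausMap V hv]
  exact sub_eq_zero.1 h1

/-! ### The peripheral spectrum and the spectral projectors -/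

theorem coe_unitary_ne_zero [Nontrivial H] (w : unitary (H →L[ℂ] H)) : (w : H →L[ℂ] H) ≠ 0 :=
  fun h => one_ne_zero (α := H →L[ℂ] H) (by
    rw [← Unitary.star_mul_self_of_mem w.2, h, mul_zero])

theorem isPrimitiveRoot_theta {z : ℕ} (hz : z ≠ 0) : IsPrimitiveRoot (theta z) z :=
  Complex.isPrimitiveRoot_exp z hz

theorem ncard_rootsGroup {z : ℕ} (hz : z ≠ 0) : (rootsGroup z).ncard = z := by
  have h1 : rootsGroup z = (fun m => theta z ^ m) '' (Finset.range z : Set ℕ) := by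
    ext μ
    simp [rootsGroup, eq_comm]
  rw [h1, Set.InjOn.ncard_image, Set.ncard_coe_finset, Finset.card_range]
  intro a ha b hb hab
  exact (isPrimitiveRoot_theta hz).pow_inj (by simpa using ha) (by simpa using hb) hab

/-- The covariance `Φ(X u) = c Φ(X) u` of the map forces the covariance of every Kraus operator.
For `D i = u (V i)^* - c (V i)^* u` it says that `∑ i, V i X D i = 0` for all `X`; since `(D i)^*`
is obtained from `V i` by a fixed linear map, also `∑ i, (D i)^* D i = 0`. -/
theorem isTwist_of_krausMap_mul {V : I → H →L[ℂ] H} {c : ℂ} {U : H →L[ℂ] H}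
    (h : ∀ X, krausMap V (X * U) = c • (krausMap V X * U)) : IsTwist V c U := by
  let D : I → H →L[ℂ] H := fun i => U * star (V i) - c • (star (V i) * U)
  have h1 : ∀ X, ∑ i, V i * X * D i = 0 := fun X => by
    have h2 := h X
    rw [krausMap_apply, krausMap_apply, Finset.sum_mul, Finset.smul_sum, ← sub_eq_zero,
      ← Finset.sum_sub_distrib] at h2
    rw [← h2]
    refine Finset.sum_congr rfl fun i _ => ?_
    simp only [D, mul_sub, mul_smul_comm, mul_assoc]
  have h3 : ∑ i, star (D i) * D i = 0 := by
    have h4 : ∀ i, star (D i) * D i =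
        V i * star U * D i - star c • (star U * (V i * 1 * D i)) := fun i => by
      conv_lhs => rw [show star (D i) = V i * star U - star c • (star U * V i) by
        simp only [D, star_sub, star_mul, star_star, star_smul]]
      rw [sub_mul, smul_mul_assoc, mul_one, mul_assoc (star U)]
    simp only [h4]
    rw [Finset.sum_sub_distrib, h1, ← Finset.smul_sum, ← Finset.mul_sum, h1]
    simp
  intro i
  have h5 := (Finset.sum_eq_zero_iff_of_nonneg fun j _ => star_mul_self_nonneg (D j)).1 h3 i
    (Finset.mem_univ i)
  exact sub_eq_zero.1 ((CStarRing.star_mul_self_eq_zero_iff _).1 h5)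

theorem IsPosDef.mul_ne_zero {A S : H →L[ℂ] H} (hA : IsPosDef A) (hS : S ≠ 0) : A * S ≠ 0 := by
  obtain ⟨B, hB⟩ := hA.exists_inverse
  have hB' : star B * A = 1 := by
    rw [← hA.1.star_eq, ← star_mul, hB, star_one]
  intro h
  exact hS (by rw [← one_mul S, ← hB', mul_assoc, h, mul_zero])

namespace IsPerronTriple

variable {W : I → H →L[ℂ] H} {t : ℝ} {ρ J : H →L[ℂ] H}

theorem smul_left (h : IsPerronTriple W t ρ J) {r : ℝ} (hr : 0 < r) :
    IsPerronTriple W t ((r : ℂ) • ρ) J :=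
  ⟨h.pos, h.left.smul hr, h.right, by rw [map_smul, h.map_eq, smul_comm], h.dual_eq⟩

theorem smul_right (h : IsPerronTriple W t ρ J) {r : ℝ} (hr : 0 < r) :
    IsPerronTriple W t ρ ((r : ℂ) • J) := by
  simpa using (h.star.smul_left hr).star

theorem exists_normalized [Nontrivial H] (h : IsPerronTriple W t ρ J) :
    ∃ ρ' J', IsPerronTriple W t ρ' J' ∧ opTrace ρ' = 1 ∧ opTrace J' = 1 := by
  have key : ∀ A : H →L[ℂ] H, IsPosDef A → ∃ r : ℝ, 0 < r ∧ opTrace ((r : ℂ) • A) = 1 := by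
    intro A hA
    obtain ⟨r, hr, hr'⟩ := hA.exists_opTrace
    refine ⟨r⁻¹, inv_pos.2 hr, ?_⟩
    rw [map_smul, hr', smul_eq_mul, ← Complex.ofReal_mul, inv_mul_cancel₀ hr.ne',
      Complex.ofReal_one]
  obtain ⟨a, ha, ha'⟩ := key ρ h.left
  obtain ⟨b, hb, hb'⟩ := key J h.right
  exact ⟨_, _, (h.smul_left ha).smul_right hb, ha', hb'⟩

/-- Up to the factor `t`, the peripheral spectrum is the set of phases of the twists of the family.
This set does not change when the Kraus operators are multiplied by nonzero scalars. -/
theorem mem_peripheralSpectrum_iff [Nontrivial H] (h : IsPerronTriple W t ρ J) {μ : ℂ} :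
    μ ∈ peripheralSpectrum (krausMap W) ↔
      ∃ c : ℂ, (‖c‖ = 1 ∧ ∃ S, S ≠ 0 ∧ IsTwist W c S) ∧ μ = t * c := by
  have ht' : (t : ℂ) ≠ 0 := by exact_mod_cast h.pos.ne'
  rw [h.peripheralSpectrum_eq, Set.mem_ofPred_eq]
  constructor
  · rintro ⟨hμ, hμt⟩
    obtain ⟨X, hX⟩ := hμ.exists_hasEigenvector
    obtain ⟨S, rfl⟩ := h.exists_eq_mul X
    have hS := right_ne_zero_of_mul hX.2
    refine ⟨μ / t, ⟨?_, S, hS, (h.norm_le_and_isTwist hS hX.apply_eq_smul).2 hμt⟩,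
      (mul_div_cancel₀ _ ht').symm⟩
    rw [norm_div, hμt, Complex.norm_real, Real.norm_of_nonneg h.pos.le, div_self h.pos.ne']
  · rintro ⟨c, ⟨hc, S, hS, hcS⟩, rfl⟩
    refine ⟨Module.End.hasEigenvalue_of_hasEigenvector (x := ρ * S)
      ⟨Module.End.mem_eigenspace_iff.2 ?_, h.left.mul_ne_zero hS⟩, ?_⟩
    · rw [hcS.krausMap_mul, h.map_eq, smul_mul_assoc, smul_smul, mul_comm c]
    · rw [norm_mul, hc, mul_one, Complex.norm_real, Real.norm_of_nonneg h.pos.le]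

theorem period_ne_zero [Nontrivial H] (h : IsPerronTriple W t ρ J) : period W ≠ 0 := by
  have hfin : (peripheralSpectrum (krausMap W)).Finite :=
    (Module.End.finite_spectrum (krausMap W)).subset fun μ hμ => hμ.1
  have hmem : (t : ℂ) ∈ peripheralSpectrum (krausMap W) :=
    h.mem_peripheralSpectrum_iff.2 ⟨1, ⟨by simp, 1, one_ne_zero, fun i => by simp⟩, by simp⟩
  exact (Set.ncard_pos hfin).2 ⟨_, hmem⟩ |>.ne'

/-- When a unitary twists the family by a primitive root of unity of order the period, its powers
already exhaust the peripheral spectrum. -/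
theorem peripheralSpectrum_eq_rootsGroup [Nontrivial H] (h : IsPerronTriple W 1 ρ J)
    {u : unitary (H →L[ℂ] H)} (hu : IsTwist W (theta (period W)) (u : H →L[ℂ] H)) :
    peripheralSpectrum (krausMap W) = rootsGroup (period W) := by
  have hz := h.period_ne_zero
  have hfin : (peripheralSpectrum (krausMap W)).Finite :=
    (Module.End.finite_spectrum (krausMap W)).subset fun μ hμ => hμ.1
  symm
  refine Set.eq_of_subset_of_ncard_le ?_ (by rw [ncard_rootsGroup hz, period]) hfin
  rintro _ ⟨m, -, rfl⟩
  refine h.mem_peripheralSpectrum_iff.2 ⟨_, ⟨?_, _, ?_, hu.pow m⟩, by simp⟩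
  · rw [norm_pow, (isPrimitiveRoot_theta hz).norm'_eq_one hz, one_pow]
  · exact coe_unitary_ne_zero (u ^ m)

/-- A unitary `u` twisting the family with phase `c` describes the eigenvalue `t c`: simplicity for
the map and its dual, the eigenvectors, and the spectral projector. -/
theorem spectral_data [Nontrivial H] (h : IsPerronTriple W t ρ J) (hW : IsIrreducibleFamily W)
    (hρJ : opTrace (ρ * J) = 1) {c : ℂ} (hc : ‖c‖ = 1) {u : unitary (H →L[ℂ] H)}
    (hu : IsTwist W c (u : H →L[ℂ] H)) :
    (ρ * (u : H →L[ℂ] H) ≠ 0 ∧ Module.End.eigenspace (krausMap W) ((t : ℂ) * c) =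
      Submodule.span ℂ {ρ * (u : H →L[ℂ] H)}) ∧
    (J * ((u⁻¹ : unitary (H →L[ℂ] H)) : H →L[ℂ] H) ≠ 0 ∧
      Module.End.eigenspace (krausMap (Star.star W)) ((t : ℂ) * c) =
        Submodule.span ℂ {J * ((u⁻¹ : unitary (H →L[ℂ] H)) : H →L[ℂ] H)}) ∧
    IsSpectralProjector (krausMap W) ((t : ℂ) * c)
      (traceRankOne (J * ((u⁻¹ : unitary (H →L[ℂ] H)) : H →L[ℂ] H)) (ρ * (u : H →L[ℂ] H))) := by
  have hc0 : c ≠ 0 := by rintro rfl; simp at hc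
  have hu' := hu.star_family hc
  have hev := h.eigenspace_mul_eq hW hc0 hu
  have hev' := h.star.eigenspace_mul_eq hW.star hc0 hu'
  refine ⟨⟨h.left.mul_ne_zero (coe_unitary_ne_zero u), hev⟩,
    ⟨h.right.mul_ne_zero (coe_unitary_ne_zero _), hev'⟩, ?_⟩
  refine isSpectralProjector_smulRight hev (fun X => ?_) ?_
  · have h1 := Module.End.mem_eigenspace_iff.1 (hev' ▸ Submodule.mem_span_singleton_self
      (J * ((u⁻¹ : unitary (H →L[ℂ] H)) : H →L[ℂ] H)))
    change opTrace (_ * krausMap W X) = _ * opTrace (_ * X)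
    rw [opTrace_mul_comm, opTrace_krausMap_mul, h1, mul_smul_comm, map_smul, smul_eq_mul,
      opTrace_mul_comm]
  · have hcomm := h.commute hW hc hu
    change opTrace (J * ((u⁻¹ : unitary (H →L[ℂ] H)) : H →L[ℂ] H) * (ρ * (u : H →L[ℂ] H))) = 1
    rw [hcomm.eq, mul_assoc, ← mul_assoc _ (u : H →L[ℂ] H), ← Unitary.star_eq_inv,
      Unitary.coe_star, Unitary.coe_star_mul_self, one_mul, opTrace_mul_comm, hρJ]

end IsPerronTriple

end KrausDeformation

end

open KrausDeformation in
theorem propositionA2 {H : Type*} [NormedAddCommGroup H] [InnerProductSpace ℂ H]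
    [CompleteSpace H] [FiniteDimensional ℂ H] {I : Type*} [Fintype I]
    (V : I → H →L[ℂ] H) (hV : KrausDeformation.IsIrreducibleKrausFamily V)
    (v : I → ℝ) (hv : ∀ i, 0 < v i)
    (u : unitary (H →L[ℂ] H)) (hu : KrausDeformation.IsPerronFrobeniusUnitary V u)
    (z : ℕ) (hz : z = KrausDeformation.period V) :
    KrausDeformation.peripheralSpectrum (KrausDeformation.krausMap V)
        = KrausDeformation.rootsGroup z ∧
    ∃ (lam : ℝ → ℝ) (J ρ : ℝ → (H →L[ℂ] H)),
      AnalyticOnNhd ℝ lam Set.univ ∧ AnalyticOnNhd ℝ J Set.univ ∧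
      AnalyticOnNhd ℝ ρ Set.univ ∧
      ∀ α : ℝ,
        0 < lam α ∧ KrausDeformation.IsPosDef (J α) ∧ KrausDeformation.IsFaithfulState (ρ α) ∧
        KrausDeformation.peripheralSpectrum (KrausDeformation.deformedMap V v α)
          = {μ : ℂ | ∃ k : ℕ, k < z ∧ μ = (lam α : ℂ) * KrausDeformation.theta z ^ k} ∧
        Commute (J α) (u : H →L[ℂ] H) ∧ Commute (ρ α) (u : H →L[ℂ] H) ∧
        KrausDeformation.opTrace (ρ α * J α) = 1 ∧
        ∀ m : ℕ, m < z →
          (ρ α * ((u ^ m : unitary (H →L[ℂ] H)) : H →L[ℂ] H) ≠ 0 ∧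
            Module.End.eigenspace (KrausDeformation.deformedMap V v α)
                ((lam α : ℂ) * KrausDeformation.theta z ^ m)
              = Submodule.span ℂ {ρ α * ((u ^ m : unitary (H →L[ℂ] H)) : H →L[ℂ] H)}) ∧
          (J α * ((u⁻¹ ^ m : unitary (H →L[ℂ] H)) : H →L[ℂ] H) ≠ 0 ∧
            Module.End.eigenspace (KrausDeformation.deformedDual V v α)
                ((lam α : ℂ) * KrausDeformation.theta z ^ m)
              = Submodule.span ℂ {J α * ((u⁻¹ ^ m : unitary (H →L[ℂ] H)) : H →L[ℂ] H)}) ∧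
          KrausDeformation.IsSpectralProjector (KrausDeformation.deformedMap V v α)
            ((lam α : ℂ) * KrausDeformation.theta z ^ m)
            (KrausDeformation.traceRankOne
              (J α * ((u⁻¹ ^ m : unitary (H →L[ℂ] H)) : H →L[ℂ] H))
              (ρ α * ((u ^ m : unitary (H →L[ℂ] H)) : H →L[ℂ] H))) := by
  have hVirr : IsIrreducibleFamily V := hV.2
  obtain ⟨ρ₀, ⟨hρ₀, hρ₀tr⟩, hρ₀eq, -⟩ := hu.exists_state
  have hH : Nontrivial H := by
    by_contra hH
    rw [not_nontrivial_iff_subsingleton] at hH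
    rw [Subsingleton.elim ρ₀ 0, map_zero] at hρ₀tr
    exact zero_ne_one hρ₀tr
  have h0 : IsPerronTriple V 1 ρ₀ 1 :=
    ⟨one_pos, hρ₀, isPosDef_one, by rw [hρ₀eq]; simp, by
      rw [krausMap_apply]
      simpa using hV.1⟩
  -- In dimension one the zero family is irreducible, so this uses the normalization of `V`.
  have hne : ∃ i, V i ≠ 0 := by
    by_contra! hall
    have := hV.1
    simp [hall] at this
  have htw : IsTwist V (theta (period V)) (u : H →L[ℂ] H) := isTwist_of_krausMap_mul hu.map_mul
  have hper := h0.peripheralSpectrum_eq_rootsGroup htw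
  have hθ : ‖theta z‖ = 1 := by
    rw [hz]
    exact (isPrimitiveRoot_theta h0.period_ne_zero).norm'_eq_one h0.period_ne_zero
  rw [← hz] at htw hper
  have hirr := hVirr.deformedFamily hv
  have htwα : ∀ α, IsTwist (deformedFamily V v α) (theta z) (u : H →L[ℂ] H) := fun α =>
    htw.smul_family _
  have hex : ∀ α, ∃ (t : ℝ) (ρ J : H →L[ℂ] H), IsPerronTriple (deformedFamily V v α) t ρ J ∧
      opTrace ρ = 1 ∧ opTrace J = 1 := fun α => by
    obtain ⟨t, ρ, J, h⟩ := (hirr α).exists_perronTriple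
      (hne.imp fun i hi => smul_ne_zero (sqrt_rpow_ne_zero hv α i) hi)
    exact ⟨t, h.exists_normalized⟩
  choose t ρ J hP hρ hJ using hex
  have hρan : AnalyticOnNhd ℝ ρ Set.univ := analyticOnNhd_perron hVirr hv hP hρ
  have hJan : AnalyticOnNhd ℝ J Set.univ := analyticOnNhd_perron hVirr.star hv
    (fun α => star_deformedFamily V v α ▸ (hP α).star) hJ
  have htan : AnalyticOnNhd ℝ t Set.univ := by
    have h1 : ∀ α, (opTrace (deformedMap V v α (ρ α))).re = t α := fun α => by
      rw [deformedMap_eq_krausMap V hv, (hP α).map_eq, map_smul, hρ, smul_eq_mul, mul_one,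
        Complex.ofReal_re]
    have h3 := Complex.reCLM.comp_analyticOnNhd
      (analyticOnNhd_opTrace (analyticOnNhd_deformedMap V hv hρan))
    exact h3.congr isOpen_univ fun α _ => h1 α
  -- The dual eigenvector is rescaled so that its pairing with `ρ α` is one.
  choose r hr hrtr using fun α => (hP α).left.exists_opTrace_mul (hP α).right
  have hran : AnalyticOnNhd ℝ (fun α => opTrace (ρ α * J α)) Set.univ :=
    analyticOnNhd_opTrace (hρan.mul hJan)
  have hJan' : AnalyticOnNhd ℝ (fun α => (((r α)⁻¹ : ℝ) : ℂ) • J α) Set.univ := by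
    have h1 : AnalyticOnNhd ℝ (fun α => (opTrace (ρ α * J α))⁻¹) Set.univ :=
      hran.inv fun α _ => by rw [hrtr]; exact_mod_cast (hr α).ne'
    refine (h1.smul hJan).congr isOpen_univ fun α _ => ?_
    simp only [hrtr, Complex.ofReal_inv]
  refine ⟨hper, t, fun α => (((r α)⁻¹ : ℝ) : ℂ) • J α, ρ, htan, hJan', hρan, fun α => ?_⟩
  have hPα := (hP α).smul_right (inv_pos.2 (hr α))
  have hρJ : opTrace (ρ α * ((((r α)⁻¹ : ℝ) : ℂ) • J α)) = 1 := by
    rw [mul_smul_comm, map_smul, hrtr, smul_eq_mul, ← Complex.ofReal_mul,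
      inv_mul_cancel₀ (hr α).ne', Complex.ofReal_one]
  have hcommJ := hPα.star.commute (hirr α).star hθ ((htwα α).star_family hθ)
  refine ⟨hPα.pos, hPα.right, ⟨hPα.left, hρ α⟩, ?_, ?_, hPα.commute (hirr α) hθ (htwα α), hρJ,
    fun m _ => ?_⟩
  · rw [deformedMap_eq_krausMap V hv]
    ext μ
    rw [hPα.mem_peripheralSpectrum_iff]
    -- The phases occurring in the twists of the deformed family are those of `V`.
    have hphase : ∀ c : ℂ, (‖c‖ = 1 ∧ ∃ S, S ≠ 0 ∧ IsTwist (deformedFamily V v α) c S) ↔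
        c ∈ rootsGroup z := fun c => by
      rw [← hper, h0.mem_peripheralSpectrum_iff]
      constructor
      · rintro ⟨hc, S, hS, hcS⟩
        exact ⟨c, ⟨hc, S, hS, hcS.of_smul_family (sqrt_rpow_ne_zero hv α)⟩, by simp⟩
      · rintro ⟨c', ⟨hc, S, hS, hcS⟩, rfl⟩
        rw [Complex.ofReal_one, one_mul]
        exact ⟨hc, S, hS, hcS.smul_family _⟩
    simp only [hphase, rootsGroup, Set.mem_ofPred_eq]
    constructor
    · rintro ⟨_, ⟨m, hm, rfl⟩, rfl⟩
      exact ⟨m, hm, rfl⟩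
    · rintro ⟨m, hm, rfl⟩
      exact ⟨_, ⟨m, hm, rfl⟩, rfl⟩
  · rw [← Unitary.star_eq_inv, Unitary.coe_star] at hcommJ
    have h1 := hcommJ.star_star
    rwa [star_star, hPα.right.1.star_eq] at h1
  · have h1 := hPα.spectral_data (hirr α) hρJ (c := theta z ^ m) (by rw [norm_pow, hθ, one_pow])
      (u := u ^ m) ((htwα α).pow m)
    rw [star_deformedFamily, ← deformedMap_eq_krausMap (star V) hv,
      ← deformedDual_eq_deformedMap, ← deformedMap_eq_krausMap V hv, ← inv_pow] at h1
    exact h1
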